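/- Let $E$ be a finite-dimensional real normed space with norm $\|\cdot\|$, $E^*$ its dual with dual norm $\|\cdot\|_*$, $Q\subset E$ a closed convex bounded set of diameter $D=\max_{x,y\in Q}\|x-y\|$, and $f,h$ real functions that are convex on $Q$. Put $\varphi=f+h$, let $x^*\in Q$ be a minimizer of $\varphi$ on $Q$, and $\varphi^*=\varphi(x^*)$. Let $d$ be a prox-function: differentiable on $Q$ and strongly convex on $Q$ with parameter $1$ with respect to $\|\cdot\|$, with $\min_Q d=0$; put $V(x,z)=d(x)-d(z)-\langle\nabla d(z),x-z\rangle$. Let $f$ be endowed with a stochastic inexact oracle with constant $L\ge 0$, bias $\delta$ and noise level $\sigma>0$: for every $x\in Q$ there are $f_{\delta,L}(x)\in\mathbb R$ and $g_{\delta,L}(x)\in E^*$ with $$0\le f(y)-f_{\delta,L}(x)-\langle g_{\delta,L}(x),y-x\rangle\le\tfrac L2\|x-y\|^2+\delta\qquad\text{for all }y\in Q,$$ and random estimates $F_{\delta,L}(x,\xi)$, $G_{\delta,L}(x,\xi)$ with $\mathbb E_\xi F_{\delta,L}(x,\xi)=f_{\delta,L}(x)$, $\mathbb E_\xi G_{\delta,L}(x,\xi)=g_{\delta,L}(x)$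 and $\mathbb E_\xi\|G_{\delta,L}(x,\xi)-g_{\delta,L}(x)\|_*^2\le\sigma^2$. Assume moreover the light-tail condition $$\mathbb E_\xi\exp\bigl(\|G_{\delta,L}(x,\xi)-g_{\delta,L}(x)\|_*^2/\sigma^2\bigr)\le\exp(1)\qquad\text{for all }x\in Q,$$ and that $\xi_0,\xi_1,\dots$ are i.i.d. copies of $\xi$. Let $p\in[1,2]$, $R>0$ with $\sqrt{2d(x^*)}\le R$, $a=2^{\frac{2p-1}2}$, $b=2^{\frac{5-2p}4}p^{\frac{1-2p}2}$, and for $i\ge 0$ $$\alpha_i=\frac1a\Bigl(\frac{i+p}p\Bigr)^{p-1},\qquad \beta_i=L+\frac{b\sigma}R(i+p+1)^{\frac{2p-1}2},\qquad B_i=a\alpha_i^2,$$ $A_k=\sum_{i=0}^k\alpha_i$, $\tau_k=\alpha_{k+1}/B_{k+1}$. Let $(y_k)_{k\ge0}$ be generated by the Stochastic Intermediate Gradient Method: with $G_i=G_{\delta,L}(x_i,\xi_i)$, $$x_0=\arg\min_{x\in Q}d(x),\qquad y_0=\arg\min_{x\in Q}\{\beta_0d(x)+\alpha_0\langle G_0,x-x_0\rangle+\alpha_0h(x)\},$$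 and, for $k\ge0$, $$z_k=\arg\min_{x\in Q}\Bigl\{\beta_kd(x)+\sum_{i=0}^k\alpha_i\langle G_i,x-x_i\rangle+A_kh(x)\Bigr\},\qquad x_{k+1}=\tau_kz_k+(1-\tau_k)y_k,$$ $$\hat x_{k+1}=\arg\min_{x\in Q}\{\beta_kV(x,z_k)+\alpha_{k+1}\langle G_{k+1},x-z_k\rangle+\alpha_{k+1}h(x)\},$$ $$w_{k+1}=\tau_k\hat x_{k+1}+(1-\tau_k)y_k,\qquad y_{k+1}=\frac{A_{k+1}-B_{k+1}}{A_{k+1}}y_k+\frac{B_{k+1}}{A_{k+1}}w_{k+1}.$$ Then for every $\Omega\ge0$ and every $k\ge1$ $$\mathbb P\Bigl(\varphi(y_k)-\varphi^*>\frac{C_1LR^2}{k^p}+\frac{C_2(1+\Omega)\sigma R}{\sqrt k}+C_3k^{p-1}\delta+\frac{C_4D\sigma\sqrt\Omega}{\sqrt k}\Bigr)\le\mathbb P\bigl(\varphi(y_k)-\varphi^*>T_k\bigr)\le3\exp(-\Omega),$$ where $C_1=4\sqrt2$, $C_2=16\sqrt2$, $C_3=48$, $C_4=4\sqrt3$ and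 $$T_k=\frac{LR^2p^p2^{\frac{2p-3}2}}{(k+p)^p}+\frac{(1+\Omega)\sigma R\,2^{\frac{3+2p}4}\sqrt p\,(k+p+2)^{p-\frac12}}{(k+p)^p}+2^{2p-1}\Bigl(\Bigl(\frac{k+p}p\Bigr)^{p-1}+1\Bigr)\delta+\frac{2D\sigma\sqrt{6\Omega p}}{\sqrt{k+p}};$$ the second inequality, $\mathbb P(\varphi(y_k)-\varphi^*>T_k)\le 3\exp(-\Omega)$, also holds for $k=0$. -/

import Mathlib

open MeasureTheory ProbabilityTheory

/-- `d` is a prox-function for `Q` with prox-center `c`: it is differentiable on `Q`, strongly convex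
on `Q` with parameter `1` with respect to the norm of `E`, and `c` minimizes `d` on `Q`, with
`d c = 0`. -/
structure IsProxFunction {E : Type*} [NormedAddCommGroup E] [NormedSpace ℝ E]
    (Q : Set E) (d : E → ℝ) (c : E) : Prop where
  differentiableOn : DifferentiableOn ℝ d Q
  strongConvexOn : StrongConvexOn Q 1 d
  center_mem : c ∈ Q
  isMinOn_center : IsMinOn d Q c
  map_center : d c = 0

/-- The Bregman distance `V(x, z) = d(x) - d(z) - ⟨∇d(z), x - z⟩` of a function `d` that is
differentiable on `Q`. For `x, z ∈ Q`, with `Q` convex, the number `⟨∇d(z), x - z⟩` does not depend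
on the choice of the derivative within `Q`; it is the usual derivative wherever that exists. -/
noncomputable def bregman {E : Type*} [NormedAddCommGroup E] [NormedSpace ℝ E]
    (Q : Set E) (d : E → ℝ) (x z : E) : ℝ :=
  d x - d z - fderivWithin ℝ d Q z (x - z)

/-- `u` is a solution of `min {ψ(x) : x ∈ Q}`. -/
def IsArgMinOn {E : Type*} (ψ : E → ℝ) (Q : Set E) (u : E) : Prop :=
  u ∈ Q ∧ IsMinOn ψ Q u

/-- `f` is endowed on `Q` with a stochastic inexact oracle with noise level `σ`, bias `δ` and
constant `L`: `(fO, gO)` is the deterministic `(δ, L)`-oracle, `(F, G)` its stochastic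
approximation, and `ν` the distribution of the random variable that drives `(F, G)`.
The norm on `StrongDual ℝ E` is the dual norm. -/
structure IsStochasticInexactOracle {E Ξ : Type*} [NormedAddCommGroup E] [NormedSpace ℝ E]
    [MeasurableSpace E] [MeasurableSpace Ξ] (Q : Set E) (f : E → ℝ) (L δ σ : ℝ)
    (ν : Measure Ξ) (fO : E → ℝ) (gO : E → StrongDual ℝ E)
    (F : E → Ξ → ℝ) (G : E → Ξ → StrongDual ℝ E) : Prop where
  lower : ∀ x ∈ Q, ∀ y ∈ Q, 0 ≤ f y - fO x - gO x (y - x)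
  upper : ∀ x ∈ Q, ∀ y ∈ Q, f y - fO x - gO x (y - x) ≤ L / 2 * ‖x - y‖ ^ 2 + δ
  measurable_G : Measurable (fun q : Q × Ξ => G q.1 q.2)
  integrable_F : ∀ x ∈ Q, Integrable (F x) ν
  integral_F : ∀ x ∈ Q, ∫ s, F x s ∂ν = fO x
  integrable_G : ∀ x ∈ Q, Integrable (G x) ν
  integral_G : ∀ x ∈ Q, ∫ s, G x s ∂ν = gO x
  integrable_sq : ∀ x ∈ Q, Integrable (fun s => ‖G x s - gO x‖ ^ 2) ν
  variance_le : ∀ x ∈ Q, ∫ s, ‖G x s - gO x‖ ^ 2 ∂ν ≤ σ ^ 2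

/-- The light-tail condition `𝔼 exp(‖G(x, ξ) - g(x)‖² / σ²) ≤ exp 1` at every `x ∈ Q`. -/
def LightTail {E Ξ : Type*} [NormedAddCommGroup E] [NormedSpace ℝ E]
    [MeasurableSpace Ξ] (Q : Set E) (σ : ℝ) (ν : Measure Ξ)
    (gO : E → StrongDual ℝ E) (G : E → Ξ → StrongDual ℝ E) : Prop :=
  ∀ x ∈ Q, ∫⁻ s, ENNReal.ofReal (Real.exp (‖G x s - gO x‖ ^ 2 / σ ^ 2)) ∂ν
    ≤ ENNReal.ofReal (Real.exp 1)

/-- The partial sums `A_k = α_0 + ⋯ + α_k`. -/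
def coefSum (α : ℕ → ℝ) (k : ℕ) : ℝ := ∑ i ∈ Finset.range (k + 1), α i

/-- The sequences `x, y, z, x̂, w` are generated by the Stochastic Intermediate Gradient Method with
coefficients `α, β, B` and prox-function `d` from the realization `s 0, s 1, …` of the noise.
The values `xhat 0` and `w 0` are not used. -/
structure IsSIGMRun {E Ξ : Type*} [NormedAddCommGroup E] [NormedSpace ℝ E]
    (Q : Set E) (h d : E → ℝ) (G : E → Ξ → StrongDual ℝ E) (α β B : ℕ → ℝ)
    (s : ℕ → Ξ) (x y z xhat w : ℕ → E) : Prop where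
  x_zero : IsArgMinOn d Q (x 0)
  y_zero : IsArgMinOn
    (fun u => β 0 * d u + α 0 * G (x 0) (s 0) (u - x 0) + α 0 * h u) Q (y 0)
  z_step : ∀ k, IsArgMinOn
    (fun u => β k * d u + ∑ i ∈ Finset.range (k + 1), α i * G (x i) (s i) (u - x i)
      + coefSum α k * h u) Q (z k)
  x_step : ∀ k, x (k + 1) =
    (α (k + 1) / B (k + 1)) • z k + (1 - α (k + 1) / B (k + 1)) • y k
  xhat_step : ∀ k, IsArgMinOn
    (fun u => β k * bregman Q d u (z k) + α (k + 1) * G (x (k + 1)) (s (k + 1)) (u - z k)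
      + α (k + 1) * h u) Q (xhat (k + 1))
  w_step : ∀ k, w (k + 1) =
    (α (k + 1) / B (k + 1)) • xhat (k + 1) + (1 - α (k + 1) / B (k + 1)) • y k
  y_step : ∀ k, y (k + 1) =
    ((coefSum α (k + 1) - B (k + 1)) / coefSum α (k + 1)) • y k
      + (B (k + 1) / coefSum α (k + 1)) • w (k + 1)

/-- The parameter `a = 2^((2p-1)/2)`. -/
noncomputable def sigmParamA (p : ℝ) : ℝ := (2 : ℝ) ^ ((2 * p - 1) / 2)

/-- The parameter `b = 2^((5-2p)/4) p^((1-2p)/2)`. -/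
noncomputable def sigmParamB (p : ℝ) : ℝ :=
  (2 : ℝ) ^ ((5 - 2 * p) / 4) * p ^ ((1 - 2 * p) / 2)

/-- `α_i = (1/a) ((i+p)/p)^(p-1)`. -/
noncomputable def sigmAlpha (p : ℝ) (i : ℕ) : ℝ :=
  1 / sigmParamA p * (((i : ℝ) + p) / p) ^ (p - 1)

/-- `β_i = L + (b σ / R) (i+p+1)^((2p-1)/2)`. -/
noncomputable def sigmBeta (L σ R p : ℝ) (i : ℕ) : ℝ :=
  L + sigmParamB p * σ / R * ((i : ℝ) + p + 1) ^ ((2 * p - 1) / 2)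

/-- `B_i = a α_i²`. -/
noncomputable def sigmB (p : ℝ) (i : ℕ) : ℝ := sigmParamA p * sigmAlpha p i ^ 2

/-! The proof separates a pathwise estimate from two tail bounds. Let η_i = G_i - g(x_i) be the
noise and v_i the point where step i starts (`proxPoint`: x_0, then z_0, z_1, …).

For every realization, induction on k bounds A_k φ(y_k) by β_k d(u) plus the accumulated linear
model at u, up to an error (`IsSIGMRun.coefSum_mul_le`). The margin β_i - L in the quadratic term
absorbs the noise along the step at the price ‖η_i‖²/(2(β_i - L)). Since the model underestimates φ
up to noise, u = x* leaves three errors (`IsSIGMRun.coefSum_mul_gap_le`): the bias Σ B_i δ, the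
squares Σ B_i‖η_i‖²/(2(β_i - L)), and the linear sum Σ α_i η_i(x* - v_i).

The squares need no independence: Jensen's inequality for exp and Markov's inequality suffice
(`measure_sum_lt_le`). In the linear sum x_i and v_i depend only on ξ_0, …, ξ_{i-1}, so it is a
martingale; boundedness of Q and the light tail make its increments sub-Gaussian
(`lintegral_exp_mul_le`), exponential moments multiply (`lintegral_exp_sum_le`), and Chernoff's
bound applies. Each bad event has probability at most exp(-Ω), so even 2 exp(-Ω) would do. Off both
events, division by A_k ≥ (1/a)((k+p)/p)^p gives T_k (`gap_le_of_noise_le`).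

Measurability of the iterates is derived, not assumed: strongly convex minimizers depend
continuously on the linear term, and the gradient of d is measurable where it matters. -/

/-! ### Convex analysis along segments -/

open Filter Topology in
/-- The difference quotients of `d` along the segment from `z` to `u` converge to the derivative
of `d` within a convex set. -/
theorem tendsto_segment_quotient {E : Type*} [NormedAddCommGroup E] [NormedSpace ℝ E]
    {Q : Set E} (hQ : Convex ℝ Q) {d : E → ℝ} (hd : DifferentiableOn ℝ d Q) {z u : E}
    (hz : z ∈ Q) (hu : u ∈ Q) :
    Tendsto (fun n : ℕ => ((n : ℝ) + 1) * (d (z + (1 / ((n : ℝ) + 1)) • (u - z)) - d z)) atTop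
      (𝓝 (fderivWithin ℝ d Q z (u - z))) := by
  have h0 : Tendsto (fun n : ℕ => 1 / ((n : ℝ) + 1)) atTop (𝓝 0) :=
    tendsto_one_div_add_atTop_nhds_zero_nat
  have h := (hd z hz).hasFDerivWithinAt.lim (α := ℕ) (l := atTop) (c := fun n => (n : ℝ) + 1)
    (d := fun n => (1 / ((n : ℝ) + 1)) • (u - z)) (v := u - z)
    (by simpa using h0.smul_const (u - z))
    (Eventually.of_forall fun n => hQ.add_smul_sub_mem hz hu ⟨by positivity, by
      rw [div_le_one (by positivity)]; linarith [n.cast_nonneg (α := ℝ)]⟩)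
    (by
      refine tendsto_const_nhds.congr fun n => ?_
      rw [smul_smul, mul_one_div_cancel (by positivity), one_smul])
  simpa only [smul_eq_mul] using h

theorem segment_eq {E : Type*} [AddCommGroup E] [Module ℝ E] (z u : E) (t : ℝ) :
    z + t • (u - z) = (1 - t) • z + t • u := by module

theorem one_div_succ_mem (n : ℕ) :
    0 < 1 / ((n : ℝ) + 1) ∧ 0 ≤ 1 - 1 / ((n : ℝ) + 1) := by
  refine ⟨by positivity, ?_⟩
  rw [sub_nonneg, div_le_one (by positivity)]
  linarith [n.cast_nonneg (α := ℝ)]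

open Filter Topology in
/-- The Bregman distance of a `1`-strongly convex function dominates half the squared distance. -/
theorem half_sq_le_bregman {E : Type*} [NormedAddCommGroup E] [NormedSpace ℝ E]
    {Q : Set E} {d : E → ℝ} (hd : DifferentiableOn ℝ d Q) (hs : StrongConvexOn Q 1 d) {x z : E}
    (hx : x ∈ Q) (hz : z ∈ Q) : 1 / 2 * ‖x - z‖ ^ 2 ≤ bregman Q d x z := by
  have h1 := tendsto_segment_quotient hs.1 hd hz hx
  have h0 : Tendsto (fun n : ℕ => 1 / ((n : ℝ) + 1)) atTop (𝓝 0) :=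
    tendsto_one_div_add_atTop_nhds_zero_nat
  have h2 : Tendsto (fun n : ℕ => d x - d z - (1 - 1 / ((n : ℝ) + 1)) * (1 / 2 * ‖x - z‖ ^ 2))
      atTop (𝓝 (d x - d z - (1 - 0) * (1 / 2 * ‖x - z‖ ^ 2))) :=
    tendsto_const_nhds.sub ((tendsto_const_nhds.sub h0).mul_const _)
  -- With weight t = 1/(n+1), strong convexity bounds each difference quotient by the matching term
  -- of `h2`; the factor 1 - t disappears in the limit.
  have h3 := le_of_tendsto_of_tendsto' h1 h2 fun n => by
    obtain ⟨ht, ht'⟩ := one_div_succ_mem n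
    have hc := hs.2 hz hx ht' ht.le (by ring)
    rw [← segment_eq, norm_sub_rev] at hc
    have hn : (0 : ℝ) < (n : ℝ) + 1 := by positivity
    set t := 1 / ((n : ℝ) + 1) with htdef
    have hnt : ((n : ℝ) + 1) * t = 1 := by rw [htdef]; field_simp
    calc ((n : ℝ) + 1) * (d (z + t • (x - z)) - d z)
        ≤ ((n : ℝ) + 1) * (t * (d x - d z - (1 - t) * (1 / 2 * ‖x - z‖ ^ 2))) := by
          refine mul_le_mul_of_nonneg_left ?_ hn.le
          simp only [smul_eq_mul] at hc
          linarith
      _ = _ := by rw [← mul_assoc, hnt, one_mul]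
  unfold bregman
  linarith

open Filter Topology in
/-- A minimizer of `β d + ψ` with `ψ` convex satisfies the three-point inequality. -/
theorem argmin_three_point {E : Type*} [NormedAddCommGroup E] [NormedSpace ℝ E]
    {Q : Set E} {d ψ : E → ℝ} (hd : DifferentiableOn ℝ d Q) (hψ : ConvexOn ℝ Q ψ) {β : ℝ}
    {x z : E} (hz : IsArgMinOn (fun u => β * d u + ψ u) Q z) (hx : x ∈ Q) :
    β * d z + ψ z + β * bregman Q d x z ≤ β * d x + ψ x := by
  have h1 := (tendsto_segment_quotient hψ.1 hd hz.1 hx).const_mul β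
  -- First-order optimality: minimality against the segment point and convexity of ψ bound β times
  -- the quotient below by ψ z - ψ x.
  have h3 := ge_of_tendsto' (b := ψ z - ψ x) h1 fun n => by
    obtain ⟨ht, ht'⟩ := one_div_succ_mem n
    have hc := hψ.2 hz.1 hx ht' ht.le (by ring)
    have hm := hz.2 (hψ.1.add_smul_sub_mem hz.1 hx ⟨ht.le, by linarith⟩)
    simp only [Set.mem_ofPred_eq] at hm
    rw [← segment_eq] at hc
    have hn : (0 : ℝ) < (n : ℝ) + 1 := by positivity
    set t := 1 / ((n : ℝ) + 1) with htdef
    have hnt : ((n : ℝ) + 1) * t = 1 := by rw [htdef]; field_simp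
    simp only [smul_eq_mul] at hc
    calc ψ z - ψ x = ((n : ℝ) + 1) * (t * (ψ z - ψ x)) := by rw [← mul_assoc, hnt, one_mul]
      _ ≤ ((n : ℝ) + 1) * (β * (d (z + t • (x - z)) - d z)) :=
          mul_le_mul_of_nonneg_left (by linarith) hn.le
      _ = _ := by ring
  unfold bregman
  linarith

open Filter Topology in
/-- Quadratic growth of a strongly convex function at a minimizer. -/
theorem StrongConvexOn.add_sq_le_of_isArgMinOn {E : Type*} [NormedAddCommGroup E]
    [NormedSpace ℝ E] {Q : Set E} {ψ : E → ℝ} {m : ℝ} (hψ : StrongConvexOn Q m ψ) {x z : E}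
    (hz : IsArgMinOn ψ Q z) (hx : x ∈ Q) : ψ z + m / 2 * ‖x - z‖ ^ 2 ≤ ψ x := by
  have h0 : Tendsto (fun n : ℕ => 1 / ((n : ℝ) + 1)) atTop (𝓝 0) :=
    tendsto_one_div_add_atTop_nhds_zero_nat
  have h2 : Tendsto (fun n : ℕ => (1 - 1 / ((n : ℝ) + 1)) * (m / 2 * ‖x - z‖ ^ 2))
      atTop (𝓝 ((1 - 0) * (m / 2 * ‖x - z‖ ^ 2))) :=
    (tendsto_const_nhds.sub h0).mul_const _
  have h3 := le_of_tendsto' (b := ψ x - ψ z) h2 fun n => by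
    obtain ⟨ht, ht'⟩ := one_div_succ_mem n
    have hc := hψ.2 hz.1 hx ht' ht.le (by ring)
    have hm := hz.2 (hψ.1.add_smul_sub_mem hz.1 hx ⟨ht.le, by linarith⟩)
    simp only [Set.mem_ofPred_eq] at hm
    rw [← segment_eq, norm_sub_rev] at hc
    set t := 1 / ((n : ℝ) + 1)
    simp only [smul_eq_mul] at hc
    refine le_of_mul_le_mul_left ?_ ht
    linarith
  linarith

/-! ### Continuity of minimizers and measurability of gradients -/

/-- The minimizer of a strongly convex function perturbed by a linear functional depends
continuously on the functional. -/
theorem exists_continuous_argmin {E : Type*} [NormedAddCommGroup E] [NormedSpace ℝ E]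
    [FiniteDimensional ℝ E] {Q : Set E} {ψ : E → ℝ} {m : ℝ} (hm : 0 < m)
    (hψ : StrongConvexOn Q m ψ) :
    ∃ Φ : StrongDual ℝ E → E, Continuous Φ ∧
      ∀ s u, IsArgMinOn (fun x => ψ x + s x) Q u → u = Φ s := by
  have hconv (s : StrongDual ℝ E) : StrongConvexOn Q m (fun x => ψ x + s x) := by
    refine ⟨hψ.1, fun x hx y hy a b ha hb hab => ?_⟩
    have h := hψ.2 hx hy ha hb hab
    simp only [map_add, map_smul, smul_eq_mul] at h ⊢
    linarith
  have hlip {s s' : StrongDual ℝ E} {u u' : E} (h : IsArgMinOn (fun x => ψ x + s x) Q u)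
      (h' : IsArgMinOn (fun x => ψ x + s' x) Q u') : ‖u - u'‖ ≤ m⁻¹ * ‖s - s'‖ := by
    have h1 := (hconv s).add_sq_le_of_isArgMinOn h h'.1
    have h2 := (hconv s').add_sq_le_of_isArgMinOn h' h.1
    rw [norm_sub_rev] at h1
    have h3 : (s' - s) (u - u') ≤ ‖s - s'‖ * ‖u - u'‖ := by
      rw [norm_sub_rev s s']
      exact (le_abs_self _).trans ((s' - s).le_opNorm _)
    simp only [sub_apply, map_sub] at h3
    -- Adding the two quadratic growth inequalities cancels ψ and leaves only (s' - s)(u - u').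
    have h4 : m * ‖u - u'‖ ^ 2 ≤ ‖s - s'‖ * ‖u - u'‖ := by linarith
    rcases (norm_nonneg (u - u')).eq_or_lt with h0 | h0
    · rw [← h0]; positivity
    · rw [inv_mul_eq_div, le_div_iff₀ hm]
      nlinarith
  classical
  -- Q is not assumed closed here, so minimizers need not exist for every s. The Lipschitz selection
  -- lives on D and is then extended; the value 0 off D plays no role.
  let D : Set (StrongDual ℝ E) := {s | ∃ u, IsArgMinOn (fun x => ψ x + s x) Q u}
  let g : StrongDual ℝ E → E := fun s => if hs : s ∈ D then hs.choose else 0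
  have hg {s : StrongDual ℝ E} (hs : s ∈ D) : IsArgMinOn (fun x => ψ x + s x) Q (g s) := by
    simp only [g, dif_pos hs]
    exact hs.choose_spec
  have hgl : LipschitzOnWith (Real.toNNReal m⁻¹) g D := by
    refine LipschitzOnWith.of_dist_le_mul fun s hs t ht => ?_
    rw [dist_eq_norm, dist_eq_norm, Real.coe_toNNReal _ (by positivity)]
    exact hlip (hg hs) (hg ht)
  obtain ⟨Φ, hΦ, hΦg⟩ := hgl.extend_finite_dimension
  refine ⟨Φ, hΦ.continuous, fun s u hu => ?_⟩
  have hs : s ∈ D := ⟨u, hu⟩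
  rw [← hΦg hs, ← sub_eq_zero, ← norm_le_zero_iff]
  simpa using hlip hu (hg hs)

/-- A function that is strongly convex and differentiable on `Q` has, for points of `Q`, a
gradient that is measurable up to functionals vanishing on differences of points of `Q`. -/
theorem exists_measurable_gradient {E : Type*} [NormedAddCommGroup E] [NormedSpace ℝ E]
    [FiniteDimensional ℝ E] [MeasurableSpace E] [BorelSpace E] {Q : Set E} (hQ : Convex ℝ Q)
    {d : E → ℝ} (hd : DifferentiableOn ℝ d Q) :
    ∃ g : Q → StrongDual ℝ E, Measurable g ∧
      ∀ z : Q, ∀ u ∈ Q, ∀ v ∈ Q, g z (u - v) = fderivWithin ℝ d Q z (u - v) := by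
  rcases Q.eq_empty_or_nonempty with rfl | ⟨u₀, hu₀⟩
  · exact ⟨fun _ => 0, measurable_const, fun z => z.2.elim⟩
  have hmeas (u : E) (hu : u ∈ Q) : Measurable fun z : Q => fderivWithin ℝ d Q z (u - z) := by
    refine measurable_of_tendsto_metrizable
      (f := fun (n : ℕ) (z : Q) => ((n : ℝ) + 1) *
        (d ((z : E) + (1 / ((n : ℝ) + 1)) • (u - z)) - d z)) (fun n => ?_)
      (tendsto_pi_nhds.2 fun z => tendsto_segment_quotient hQ hd z.2 hu)
    have hc : ContinuousOn d Q := hd.continuousOn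
    refine Continuous.measurable (continuous_const.mul (Continuous.sub ?_ ?_))
    · refine hc.comp_continuous (by fun_prop) fun z => ?_
      obtain ⟨ht, ht'⟩ := one_div_succ_mem n
      exact hQ.add_smul_sub_mem z.2 hu ⟨ht.le, by linarith⟩
    · exact hc.comp_continuous continuous_subtype_val fun z => z.2
  have hmeas' (u : E) (hu : u ∈ Q) : Measurable fun z : Q => fderivWithin ℝ d Q z (u - u₀) := by
    -- Subtracting the value in direction u₀ - z makes the direction independent of z.
    have h := (hmeas u hu).sub (hmeas u₀ hu₀)
    refine (funext fun z => ?_ : (fun z : Q => fderivWithin ℝ d Q z (u - u₀)) = _) ▸ h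
    simp [map_sub]
  -- The derivative within Q is determined only on the span of Q - u₀. A basis of that span taken
  -- from Q - u₀ has measurable coefficients, and its coordinate functionals extend to E.
  obtain ⟨e, he, hspan, hli⟩ :=
    Submodule.exists_fun_fin_finrank_span_eq ℝ ((fun u => u - u₀) '' Q)
  let b := Module.Basis.span hli
  choose c hc using fun i => LinearMap.exists_extend (b.coord i)
  refine ⟨fun z => ∑ i, fderivWithin ℝ d Q z (e i) • LinearMap.toContinuousLinearMap (c i),
    ?_, fun z u hu v hv => ?_⟩
  · refine Finset.measurable_sum _ fun i _ => ?_
    obtain ⟨u, hu, hue⟩ := he i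
    have := hmeas' u hu
    simp only [hue] at this
    exact this.smul_const _
  · have hmem : u - v ∈ Submodule.span ℝ (Set.range e) := by
      rw [hspan, show u - v = (u - u₀) - (v - u₀) by abel]
      exact Submodule.sub_mem _ (Submodule.subset_span ⟨u, hu, rfl⟩)
        (Submodule.subset_span ⟨v, hv, rfl⟩)
    have hsum : ∑ i, c i (u - v) • e i = u - v := by
      have h1 := congrArg Subtype.val (b.sum_repr ⟨u - v, hmem⟩)
      rw [Submodule.coe_sum] at h1
      refine Eq.trans (Finset.sum_congr rfl fun i _ => ?_) h1
      have h2 := LinearMap.congr_fun (hc i) ⟨u - v, hmem⟩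
      simp only [LinearMap.comp_apply, Submodule.subtype_apply] at h2
      rw [h2, Submodule.coe_smul, Module.Basis.span_apply]
      rfl
    conv_rhs => rw [← hsum]
    simp [map_sum, mul_comm]

/-! ### The pathwise estimating-sequence inequality -/

/-- The point from which step `i` of the method starts: the prox-center, then `z 0, z 1, …`. -/
def proxPoint {E : Type*} (x z : ℕ → E) : ℕ → E
  | 0 => x 0
  | i + 1 => z i

theorem coefSum_succ (α : ℕ → ℝ) (k : ℕ) : coefSum α (k + 1) = coefSum α k + α (k + 1) :=
  Finset.sum_range_succ α (k + 1)

theorem coefSum_zero (α : ℕ → ℝ) : coefSum α 0 = α 0 := by simp [coefSum]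

/-- Completing the square. With a = β - L it trades noise of norm n along a step of length r for a
term free of r. -/
theorem neg_sq_div_le {a r n : ℝ} (ha : 0 < a) : -(n ^ 2 / (2 * a)) ≤ a / 2 * r ^ 2 - n * r := by
  have h : a / 2 * r ^ 2 - n * r + n ^ 2 / (2 * a) = (a * r - n) ^ 2 / (2 * a) := by
    field_simp; ring
  have : 0 ≤ (a * r - n) ^ 2 / (2 * a) := by positivity
  linarith

theorem neg_opNorm_mul_le {E : Type*} [NormedAddCommGroup E] [NormedSpace ℝ E]
    (s : StrongDual ℝ E) (v : E) : -(‖s‖ * ‖v‖) ≤ s v :=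
  (abs_le.1 (s.le_opNorm v)).1

/-- Convexity for a combination with unnormalized weights `s + t = A`. -/
theorem ConvexOn.combo_le {E : Type*} [AddCommGroup E] [Module ℝ E] {Q : Set E}
    {f : E → ℝ} (hf : ConvexOn ℝ Q f) {u v : E} (hu : u ∈ Q) (hv : v ∈ Q) {s t A : ℝ}
    (hs : 0 ≤ s) (ht : 0 ≤ t) (hA : 0 < A) (hst : s + t = A) :
    A * f ((s / A) • u + (t / A) • v) ≤ s * f u + t * f v := by
  have h := hf.2 hu hv (div_nonneg hs hA.le) (div_nonneg ht hA.le)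
    (by rw [← add_div, hst, div_self hA.ne'])
  simp only [smul_eq_mul] at h
  have h' := mul_le_mul_of_nonneg_left h hA.le
  refine h'.trans_eq ?_
  field_simp

section Run

variable {E Ξ : Type*} [NormedAddCommGroup E] [NormedSpace ℝ E] {Q : Set E} {f h d : E → ℝ}
  {G : E → Ξ → StrongDual ℝ E} {α β B : ℕ → ℝ} {s : ℕ → Ξ} {x y z xhat w : ℕ → E}

theorem one_sub_div_of_pos {α B : ℝ} (hB : 0 < B) : 1 - α / B = (B - α) / B := by
  field_simp

/-- All iterates of the method are feasible. -/
theorem IsSIGMRun.mem (hrun : IsSIGMRun Q h d G α β B s x y z xhat w) (hQ : Convex ℝ Q)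
    (hα : ∀ i, 0 ≤ α i) (hBpos : ∀ i, 0 < B i) (hαB : ∀ i, α i ≤ B i)
    (hBA : ∀ i, B i ≤ coefSum α i) (k : ℕ) : x k ∈ Q ∧ y k ∈ Q := by
  have hcombo {u v : E} (hu : u ∈ Q) (hv : v ∈ Q) (i : ℕ) :
      (α i / B i) • u + (1 - α i / B i) • v ∈ Q :=
    hQ hu hv (div_nonneg (hα i) (hBpos i).le)
      (sub_nonneg.2 ((div_le_one (hBpos i)).2 (hαB i))) (by ring)
  induction k with
  | zero => exact ⟨hrun.x_zero.1, hrun.y_zero.1⟩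
  | succ k ih =>
    refine ⟨hrun.x_step k ▸ hcombo (hrun.z_step k).1 ih.2 _, ?_⟩
    have hA : 0 < coefSum α (k + 1) := (hBpos _).trans_le (hBA _)
    rw [hrun.y_step k]
    refine hQ ih.2 (hrun.w_step k ▸ hcombo (hrun.xhat_step k).1 ih.2 _)
      (div_nonneg (sub_nonneg.2 (hBA _)) hA.le) (div_nonneg (hBpos _).le hA.le) ?_
    field_simp
    ring

/-- The inexact model of the objective accumulated in `k + 1` steps. -/
noncomputable def sigmModel (fO : E → ℝ) (G : E → Ξ → StrongDual ℝ E) (h : E → ℝ) (α : ℕ → ℝ)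
    (s : ℕ → Ξ) (x : ℕ → E) (k : ℕ) (u : E) : ℝ :=
  ∑ i ∈ Finset.range (k + 1), α i * (fO (x i) + G (x i) (s i) (u - x i) + h u)

theorem sigmModel_succ (fO : E → ℝ) (k : ℕ) (u : E) :
    sigmModel fO G h α s x (k + 1) u = sigmModel fO G h α s x k u
      + α (k + 1) * (fO (x (k + 1)) + G (x (k + 1)) (s (k + 1)) (u - x (k + 1)) + h u) :=
  Finset.sum_range_succ _ _

/-- The first sum does not involve u, so z_k also minimizes β_k d plus the model. -/
theorem sigmModel_eq (fO : E → ℝ) (k : ℕ) (u : E) :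
    sigmModel fO G h α s x k u = ∑ i ∈ Finset.range (k + 1), α i * fO (x i)
      + (∑ i ∈ Finset.range (k + 1), α i * G (x i) (s i) (u - x i) + coefSum α k * h u) := by
  simp only [sigmModel, coefSum, Finset.sum_mul, mul_add, Finset.sum_add_distrib]
  ring

theorem convexOn_sigmModel (hh : ConvexOn ℝ Q h) (hα : ∀ i, 0 ≤ α i) (fO : E → ℝ) (k : ℕ) :
    ConvexOn ℝ Q (sigmModel fO G h α s x k) := by
  refine ⟨hh.1, fun u hu v hv a b ha hb hab => ?_⟩
  simp only [sigmModel, Finset.smul_sum, ← Finset.sum_add_distrib]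
  refine Finset.sum_le_sum fun i _ => ?_
  have h1 := hh.2 hu hv ha hb hab
  have h2 : (a • u + b • v) - x i = a • (u - x i) + b • (v - x i) := by
    have : x i = a • x i + b • x i := by rw [← add_smul, hab, one_smul]
    conv_lhs => rw [this]
    module
  rw [h2, map_add, map_smul, map_smul]
  simp only [smul_eq_mul] at h1 ⊢
  have h3 : a * (α i * (fO (x i) + G (x i) (s i) (u - x i) + h u))
      + b * (α i * (fO (x i) + G (x i) (s i) (v - x i) + h v))
      = α i * ((a + b) * fO (x i) + (a * G (x i) (s i) (u - x i) + b * G (x i) (s i) (v - x i))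
        + (a * h u + b * h v)) := by ring
  rw [h3, hab, one_mul]
  exact mul_le_mul_of_nonneg_left (by linarith) (hα i)

/-- The accumulated error in the estimating-sequence inequality. -/
noncomputable def sigmError (gO : E → StrongDual ℝ E) (G : E → Ξ → StrongDual ℝ E) (L δ : ℝ)
    (α β B : ℕ → ℝ) (s : ℕ → Ξ) (x z : ℕ → E) (k : ℕ) : ℝ :=
  ∑ i ∈ Finset.range (k + 1), (B i * δ
    + B i / (2 * (β i - L)) * ‖G (x i) (s i) - gO (x i)‖ ^ 2
    - α i * (G (x i) (s i) - gO (x i)) (proxPoint x z i - x i))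

/-- The estimating-sequence inequality. -/
theorem IsSIGMRun.coefSum_mul_le (hrun : IsSIGMRun Q h d G α β B s x y z xhat w)
    (hf : ConvexOn ℝ Q f) (hh : ConvexOn ℝ Q h) {c : E} (hd : IsProxFunction Q d c)
    {L δ : ℝ} {fO : E → ℝ} {gO : E → StrongDual ℝ E}
    (hlower : ∀ x ∈ Q, ∀ y ∈ Q, 0 ≤ f y - fO x - gO x (y - x))
    (hupper : ∀ x ∈ Q, ∀ y ∈ Q, f y - fO x - gO x (y - x) ≤ L / 2 * ‖x - y‖ ^ 2 + δ)
    (hα : ∀ i, 0 < α i) (hα0 : α 0 ≤ 1) (hB0 : B 0 = α 0)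
    (hβL : ∀ i, L < β i) (hL : 0 ≤ L) (hβ : Monotone β) (hαB : ∀ i, α i ≤ B i)
    (hBA : ∀ i, B i ≤ coefSum α i) (hαβ : ∀ i, α (i + 1) ^ 2 * β (i + 1) ≤ B (i + 1) * β i)
    (k : ℕ) {u : E} (hu : u ∈ Q) :
    coefSum α k * (f (y k) + h (y k))
      ≤ β k * d u + sigmModel fO G h α s x k u + sigmError gO G L δ α β B s x z k := by
  have hBpos : ∀ i, 0 < B i := fun i => (hα i).trans_le (hαB i)
  have hmem := hrun.mem hh.1 (fun i => (hα i).le) hBpos hαB hBA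
  have hd0 : ∀ u ∈ Q, 0 ≤ d u := fun u hu => by
    have := hd.isMinOn_center hu
    simpa [hd.map_center] using this
  induction k generalizing u with
  | zero =>
    have hy := hrun.y_zero.2 hu
    simp only [Set.mem_ofPred_eq] at hy
    -- With d(x_0) = 0, quadratic growth at x_0 gives ‖y_0 - x_0‖²/2 ≤ d(y_0), which pays for the
    -- quadratic term because α_0 ≤ 1.
    have hdx : d (x 0) = 0 := le_antisymm
      (by simpa [hd.map_center] using hrun.x_zero.2 hd.center_mem) (hd0 _ hrun.x_zero.1)
    have hq := hd.strongConvexOn.add_sq_le_of_isArgMinOn hrun.x_zero (hmem 0).2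
    have hup := hupper _ (hmem 0).1 _ (hmem 0).2
    set η := G (x 0) (s 0) - gO (x 0) with hη
    have hG : G (x 0) (s 0) (y 0 - x 0) = gO (x 0) (y 0 - x 0) + η (y 0 - x 0) := by simp [hη]
    have hηn := neg_opNorm_mul_le η (y 0 - x 0)
    have hy2 := neg_sq_div_le (a := β 0 - L) (r := ‖y 0 - x 0‖) (n := ‖η‖) (sub_pos.2 (hβL 0))
    rw [norm_sub_rev] at hup
    have hE : sigmError gO G L δ α β B s x z 0
        = α 0 * δ + α 0 / (2 * (β 0 - L)) * ‖η‖ ^ 2 := by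
      simp [sigmError, hB0, proxPoint, hη]
    have hM : sigmModel fO G h α s x 0 u
        = α 0 * (fO (x 0) + G (x 0) (s 0) (u - x 0) + h u) := by
      simp [sigmModel]
    rw [hE, hM, coefSum_zero]
    have hdiv : α 0 / (2 * (β 0 - L)) * ‖η‖ ^ 2 = α 0 * (‖η‖ ^ 2 / (2 * (β 0 - L))) := by ring
    have key : f (y 0) ≤ fO (x 0) + G (x 0) (s 0) (y 0 - x 0) + β 0 / 2 * ‖y 0 - x 0‖ ^ 2
        + δ + ‖η‖ ^ 2 / (2 * (β 0 - L)) := by linarith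
    have key2 := mul_le_mul_of_nonneg_left key (hα 0).le
    have hβ0 : 0 < β 0 := hL.trans_lt (hβL 0)
    have key3 : α 0 * (β 0 / 2 * ‖y 0 - x 0‖ ^ 2) ≤ β 0 * d (y 0) := by
      calc α 0 * (β 0 / 2 * ‖y 0 - x 0‖ ^ 2) ≤ 1 * (β 0 / 2 * ‖y 0 - x 0‖ ^ 2) :=
            mul_le_mul_of_nonneg_right hα0 (by positivity)
        _ = β 0 * (1 / 2 * ‖y 0 - x 0‖ ^ 2) := by ring
        _ ≤ β 0 * d (y 0) := mul_le_mul_of_nonneg_left (by linarith) hβ0.le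
    rw [hdiv]
    linarith
  | succ k ih =>
    have hxk := (hmem (k + 1)).1
    have hyk := (hmem k).2
    have hzk := (hrun.z_step k).1
    have hxh := (hrun.xhat_step k).1
    have hz : IsArgMinOn (fun u => β k * d u + sigmModel fO G h α s x k u) Q (z k) := by
      refine ⟨hzk, fun v hv => ?_⟩
      have := (hrun.z_step k).2 hv
      simp only [Set.mem_ofPred_eq, sigmModel_eq] at this ⊢
      linarith
    have h3 := argmin_three_point hd.differentiableOn
      (convexOn_sigmModel hh (fun i => (hα i).le) fO k) hz hu
    -- The induction hypothesis is used at z_k, not at u. In the final sum the values at z_k cancel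
    -- against `h3`, and V(u, z_k) cancels between `h3` and `h5`.
    have h4 := ih hzk
    have h5 := (hrun.xhat_step k).2 hu
    simp only [Set.mem_ofPred_eq] at h5
    have hβd : β k * d u ≤ β (k + 1) * d u :=
      mul_le_mul_of_nonneg_right (hβ k.le_succ) (hd0 u hu)
    have hτ := one_sub_div_of_pos (α := α (k + 1)) (hBpos (k + 1))
    set a := α (k + 1) with ha
    set b := B (k + 1) with hb
    set A := coefSum α (k + 1) with hA
    have ha0 : 0 < a := hα _
    have hb0 : 0 < b := hBpos _
    have hab : a ≤ b := hαB _
    have hbA : b ≤ A := hBA _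
    have hA0 : 0 < A := hb0.trans_le hbA
    set η := G (x (k + 1)) (s (k + 1)) - gO (x (k + 1)) with hη
    have hGη : ∀ v, G (x (k + 1)) (s (k + 1)) v = gO (x (k + 1)) v + η v := by simp [hη]
    have hxs := hrun.x_step k
    have hws := hrun.w_step k
    have hys := hrun.y_step k
    rw [← ha, ← hb, hτ] at hxs hws
    rw [← hb, ← hA] at hys
    have hwmem : w (k + 1) ∈ Q := by
      rw [hws]
      exact hh.1 hxh hyk (by positivity) (div_nonneg (by linarith) hb0.le) (by field_simp; ring)
    -- the value at `y (k + 1)`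
    have hyf : A * f (y (k + 1)) ≤ (A - b) * f (y k) + b * f (w (k + 1)) := by
      rw [hys]; exact hf.combo_le hyk hwmem (by linarith) hb0.le hA0 (by ring)
    have hyh : A * h (y (k + 1)) ≤ (A - b) * h (y k) + b * h (w (k + 1)) := by
      rw [hys]; exact hh.combo_le hyk hwmem (by linarith) hb0.le hA0 (by ring)
    have hwh : b * h (w (k + 1)) ≤ a * h (xhat (k + 1)) + (b - a) * h (y k) := by
      rw [hws]; exact hh.combo_le hxh hyk ha0.le (by linarith) hb0 (by ring)
    -- vector identities
    have hwx : b • (w (k + 1) - x (k + 1)) = a • (xhat (k + 1) - z k) := by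
      rw [hws, hxs]
      have h1 : b * (a / b) = a := by field_simp
      rw [add_sub_add_right_eq_sub, ← smul_sub, smul_smul, h1]
    have hwx' : b • (w (k + 1) - x (k + 1))
        = a • (xhat (k + 1) - x (k + 1)) + (b - a) • (y k - x (k + 1)) := by
      have h1 : b • w (k + 1) = a • xhat (k + 1) + (b - a) • y k := by
        rw [hws, smul_add, smul_smul, smul_smul, mul_div_cancel₀ _ hb0.ne',
          mul_div_cancel₀ _ hb0.ne']
      rw [smul_sub, h1]
      module
    have hg1 : b * gO (x (k + 1)) (w (k + 1) - x (k + 1))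
        = a * gO (x (k + 1)) (xhat (k + 1) - x (k + 1))
          + (b - a) * gO (x (k + 1)) (y k - x (k + 1)) := by
      have := congrArg (gO (x (k + 1))) hwx'
      simpa only [map_add, map_smul, smul_eq_mul] using this
    have hη1 : b * η (w (k + 1) - x (k + 1)) = a * η (xhat (k + 1) - z k) := by
      have := congrArg η hwx
      simpa only [map_smul, smul_eq_mul] using this
    have hnorm : b * ‖w (k + 1) - x (k + 1)‖ = a * ‖xhat (k + 1) - z k‖ := by
      have := congrArg norm hwx
      simpa only [norm_smul, Real.norm_of_nonneg hb0.le, Real.norm_of_nonneg ha0.le] using this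
    -- the quadratic term
    have hV := half_sq_le_bregman hd.differentiableOn hd.strongConvexOn hxh hzk
    have hβk : 0 < β k := hL.trans_lt (hβL k)
    -- The smoothness term at w_{k+1} is paid for by the Bregman term at x̂_{k+1}; this is the role
    -- of α_{k+1}² β_{k+1} ≤ B_{k+1} β_k.
    have hquad : b * (β (k + 1) / 2 * ‖w (k + 1) - x (k + 1)‖ ^ 2)
        ≤ β k * bregman Q d (xhat (k + 1)) (z k) := by
      have h1 : a ^ 2 * (b * (β (k + 1) / 2 * ‖w (k + 1) - x (k + 1)‖ ^ 2))
          ≤ a ^ 2 * (β k * (1 / 2 * ‖xhat (k + 1) - z k‖ ^ 2)) := by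
        calc a ^ 2 * (b * (β (k + 1) / 2 * ‖w (k + 1) - x (k + 1)‖ ^ 2))
            = (a ^ 2 * β (k + 1)) * (b / 2 * ‖w (k + 1) - x (k + 1)‖ ^ 2) := by ring
          _ ≤ (b * β k) * (b / 2 * ‖w (k + 1) - x (k + 1)‖ ^ 2) :=
              mul_le_mul_of_nonneg_right (hαβ k) (by positivity)
          _ = β k / 2 * (b * ‖w (k + 1) - x (k + 1)‖) ^ 2 := by ring
          _ = _ := by rw [hnorm]; ring
      exact (le_of_mul_le_mul_left h1 (by positivity)).trans
        (mul_le_mul_of_nonneg_left hV hβk.le)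
    -- oracle inequalities
    have hlow := hlower _ hxk _ hyk
    have hup := hupper _ hxk _ hwmem
    rw [norm_sub_rev] at hup
    have hβL1 : 0 < β (k + 1) - L := sub_pos.2 (hβL _)
    have hηn := neg_opNorm_mul_le η (w (k + 1) - x (k + 1))
    have hy2 := neg_sq_div_le (r := ‖w (k + 1) - x (k + 1)‖) (n := ‖η‖) hβL1
    have hw1 : b * f (w (k + 1)) ≤ b * (fO (x (k + 1)) + gO (x (k + 1)) (w (k + 1) - x (k + 1))
        + β (k + 1) / 2 * ‖w (k + 1) - x (k + 1)‖ ^ 2 + η (w (k + 1) - x (k + 1)) + δ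
        + ‖η‖ ^ 2 / (2 * (β (k + 1) - L))) :=
      mul_le_mul_of_nonneg_left (by linarith) hb0.le
    -- The part b - a of the linearization returns to f(y_k), whose total weight becomes (A - b) +
    -- (b - a) = A_k.
    have hlow1 : 0 ≤ (b - a) * (f (y k) - fO (x (k + 1)) - gO (x (k + 1)) (y k - x (k + 1))) :=
      mul_nonneg (by linarith) hlow
    have hE : sigmError gO G L δ α β B s x z (k + 1) = sigmError gO G L δ α β B s x z k
        + (b * δ + b * (‖η‖ ^ 2 / (2 * (β (k + 1) - L)))
          - a * η (z k - x (k + 1))) := by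
      rw [sigmError, Finset.sum_range_succ, ← hη, ← ha, ← hb]
      simp only [sigmError, proxPoint]
      ring
    have hAk : coefSum α k = A - a := by rw [hA, coefSum_succ]; ring
    rw [hE, sigmModel_succ, ← ha]
    rw [hAk] at h4
    rw [hGη, hGη] at h5
    rw [hGη]
    simp only [map_sub] at h5 hg1 hη1 hw1 hlow1 ⊢
    linarith

/-- The deterministic bound for the gap: it isolates the squared noise and a martingale. -/
theorem IsSIGMRun.coefSum_mul_gap_le (hrun : IsSIGMRun Q h d G α β B s x y z xhat w)
    (hf : ConvexOn ℝ Q f) (hh : ConvexOn ℝ Q h) {c : E} (hd : IsProxFunction Q d c)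
    {L δ : ℝ} {fO : E → ℝ} {gO : E → StrongDual ℝ E}
    (hlower : ∀ x ∈ Q, ∀ y ∈ Q, 0 ≤ f y - fO x - gO x (y - x))
    (hupper : ∀ x ∈ Q, ∀ y ∈ Q, f y - fO x - gO x (y - x) ≤ L / 2 * ‖x - y‖ ^ 2 + δ)
    (hα : ∀ i, 0 < α i) (hα0 : α 0 ≤ 1) (hB0 : B 0 = α 0)
    (hβL : ∀ i, L < β i) (hL : 0 ≤ L) (hβ : Monotone β) (hαB : ∀ i, α i ≤ B i)
    (hBA : ∀ i, B i ≤ coefSum α i) (hαβ : ∀ i, α (i + 1) ^ 2 * β (i + 1) ≤ B (i + 1) * β i)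
    (k : ℕ) {u : E} (hu : u ∈ Q) :
    coefSum α k * ((f (y k) + h (y k)) - (f u + h u))
      ≤ β k * d u + (∑ i ∈ Finset.range (k + 1), B i) * δ
        + ∑ i ∈ Finset.range (k + 1),
          B i / (2 * (β i - L)) * ‖G (x i) (s i) - gO (x i)‖ ^ 2
        + ∑ i ∈ Finset.range (k + 1),
          α i * (G (x i) (s i) - gO (x i)) (u - proxPoint x z i) := by
  have h1 := hrun.coefSum_mul_le hf hh hd hlower hupper hα hα0 hB0 hβL hL hβ hαB hBA hαβ k hu
  have hmem := hrun.mem hh.1 (fun i => (hα i).le) (fun i => (hα i).trans_le (hαB i)) hαB hBA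
  have h2 : sigmModel fO G h α s x k u ≤ coefSum α k * (f u + h u)
      + ∑ i ∈ Finset.range (k + 1), α i * (G (x i) (s i) - gO (x i)) (u - x i) := by
    rw [sigmModel, coefSum, Finset.sum_mul, ← Finset.sum_add_distrib]
    refine Finset.sum_le_sum fun i _ => ?_
    rw [← mul_add]
    refine mul_le_mul_of_nonneg_left ?_ (hα i).le
    have := hlower _ (hmem i).1 _ hu
    simp only [sub_apply]
    linarith
  -- The query points x_i cancel, so each noise term acts on u minus the point where step i starts.
  have h3 : ∑ i ∈ Finset.range (k + 1), α i * (G (x i) (s i) - gO (x i)) (u - x i)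
      - ∑ i ∈ Finset.range (k + 1), α i * (G (x i) (s i) - gO (x i)) (proxPoint x z i - x i)
      = ∑ i ∈ Finset.range (k + 1),
          α i * (G (x i) (s i) - gO (x i)) (u - proxPoint x z i) := by
    rw [← Finset.sum_sub_distrib]
    refine Finset.sum_congr rfl fun i _ => ?_
    simp only [map_sub]
    ring
  simp only [sigmError, Finset.sum_add_distrib, Finset.sum_sub_distrib, ← Finset.sum_mul] at h1
  rw [Finset.sum_mul]
  rw [Finset.sum_mul] at h1
  linarith

end Run

/-! ### Growth of the coefficients and the explicit constants -/

section Parameters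

variable {p : ℝ}

theorem sigmParamA_pos (p : ℝ) : 0 < sigmParamA p := Real.rpow_pos_of_pos two_pos _

theorem one_le_sigmParamA (hp : 1 ≤ p) : 1 ≤ sigmParamA p :=
  Real.one_le_rpow one_le_two (by linarith)

theorem sigmParamB_pos (hp : 1 ≤ p) : 0 < sigmParamB p :=
  mul_pos (Real.rpow_pos_of_pos two_pos _) (Real.rpow_pos_of_pos (by linarith) _)

theorem two_rpow_mul_two (p : ℝ) : (2 : ℝ) ^ ((2 * p - 3) / 2) * 2 = sigmParamA p := by
  rw [sigmParamA, ← Real.rpow_add_one two_ne_zero]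
  congr 1; ring

theorem sigmParamB_mul_sigmParamA (hp : 1 ≤ p) :
    sigmParamB p * sigmParamA p * p ^ p = 2 * ((2 : ℝ) ^ ((2 * p - 1) / 4) * √p) := by
  have hp0 : 0 < p := by linarith
  rw [sigmParamB, sigmParamA, Real.sqrt_eq_rpow]
  calc _ = ((2 : ℝ) ^ ((5 - 2 * p) / 4) * (2 : ℝ) ^ ((2 * p - 1) / 2))
        * (p ^ ((1 - 2 * p) / 2) * p ^ p) := by ring
    _ = (2 : ℝ) ^ ((2 * p - 1) / 4 + 1) * p ^ (1 / 2 : ℝ) := by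
      rw [← Real.rpow_add two_pos, ← Real.rpow_add hp0]
      congr 2 <;> ring
    _ = _ := by rw [Real.rpow_add_one two_ne_zero]; ring

/-- This makes b²a p^(2p-2) = 4/p, at least 2 exactly when p ≤ 2: then the squared-noise bound does
not exceed the noise part of β_k R²/2. -/
theorem sigmParamB_sq_mul_sigmParamA (hp : 1 ≤ p) :
    sigmParamB p ^ 2 * sigmParamA p * (p ^ (p - 1)) ^ 2 * p = 4 := by
  have hp0 : 0 < p := by linarith
  rw [sigmParamB, sigmParamA]
  calc _ = ((2 : ℝ) ^ ((5 - 2 * p) / 4) * (2 : ℝ) ^ ((5 - 2 * p) / 4)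
          * (2 : ℝ) ^ ((2 * p - 1) / 2))
        * (p ^ ((1 - 2 * p) / 2) * p ^ ((1 - 2 * p) / 2) * p ^ (p - 1) * p ^ (p - 1) * p ^ (1 : ℝ))
        := by rw [Real.rpow_one]; ring
    _ = (2 : ℝ) ^ (2 : ℝ) * p ^ (0 : ℝ) := by
      simp only [← Real.rpow_add two_pos, ← Real.rpow_add hp0]
      congr 2 <;> ring
    _ = 4 := by rw [Real.rpow_zero]; norm_num

theorem one_le_add_div (hp : 1 ≤ p) (i : ℕ) : 1 ≤ ((i : ℝ) + p) / p := by
  rw [le_div_iff₀ (by linarith)]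
  linarith [i.cast_nonneg (α := ℝ)]

theorem sigmAlpha_pos (hp : 1 ≤ p) (i : ℕ) : 0 < sigmAlpha p i :=
  mul_pos (one_div_pos.2 (sigmParamA_pos p))
    (Real.rpow_pos_of_pos (by linarith [one_le_add_div hp i]) _)

theorem sigmParamA_mul_sigmAlpha (p : ℝ) (i : ℕ) :
    sigmParamA p * sigmAlpha p i = (((i : ℝ) + p) / p) ^ (p - 1) := by
  rw [sigmAlpha, ← mul_assoc, mul_one_div_cancel (sigmParamA_pos p).ne', one_mul]

theorem sigmAlpha_zero (hp : 1 ≤ p) : sigmAlpha p 0 = 1 / sigmParamA p := by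
  rw [sigmAlpha]
  simp [div_self (show p ≠ 0 by linarith)]

theorem sigmAlpha_zero_le_one (hp : 1 ≤ p) : sigmAlpha p 0 ≤ 1 := by
  rw [sigmAlpha_zero hp, div_le_one (sigmParamA_pos p)]
  exact one_le_sigmParamA hp

theorem sigmB_zero (hp : 1 ≤ p) : sigmB p 0 = sigmAlpha p 0 := by
  have := (sigmParamA_pos p).ne'
  rw [sigmB, sigmAlpha_zero hp]
  field_simp

theorem sigmAlpha_mono (hp : 1 ≤ p) : Monotone (sigmAlpha p) := by
  intro i j hij
  refine mul_le_mul_of_nonneg_left (Real.rpow_le_rpow (by linarith [one_le_add_div hp i]) ?_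
    (by linarith)) (one_div_pos.2 (sigmParamA_pos p)).le
  have : (i : ℝ) ≤ j := by exact_mod_cast hij
  gcongr

theorem sigmAlpha_le_sigmB (hp : 1 ≤ p) (i : ℕ) : sigmAlpha p i ≤ sigmB p i := by
  have h1 : 1 ≤ sigmParamA p * sigmAlpha p i := by
    rw [sigmParamA_mul_sigmAlpha]
    exact Real.one_le_rpow (one_le_add_div hp i) (by linarith)
  have := sigmAlpha_pos hp i
  rw [sigmB]
  nlinarith

/-- Induction with Bernoulli's inequality: t^p - t^(p-1) ≤ (t - 1/p)^p for t = (k+1+p)/p. -/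
theorem div_rpow_le_coefSum (hp : 1 ≤ p) (k : ℕ) :
    1 / sigmParamA p * (((k : ℝ) + p) / p) ^ p ≤ coefSum (sigmAlpha p) k := by
  have hp0 : 0 < p := by linarith
  induction k with
  | zero =>
    rw [coefSum_zero, sigmAlpha_zero hp]
    simp [div_self hp0.ne']
  | succ k ih =>
    rw [coefSum_succ]
    have ht := one_le_add_div hp (k + 1)
    set t := (((k + 1 : ℕ) : ℝ) + p) / p with htdef
    have ht0 : 0 < t := by linarith
    have hk : ((k : ℝ) + p) / p = t * (1 + -(1 / (p * t))) := by
      rw [htdef]; push_cast; field_simp; ring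
    have hle : 1 / (p * t) ≤ 1 := by
      rw [div_le_one (by positivity)]; nlinarith
    have hb := one_add_mul_self_le_rpow_one_add (s := -(1 / (p * t))) (by linarith) hp
    have h1 : t ^ p - t ^ (p - 1) ≤ (((k : ℝ) + p) / p) ^ p := by
      rw [hk, Real.mul_rpow ht0.le (by linarith)]
      have h2 : t ^ p - t ^ (p - 1) = t ^ p * (1 + p * -(1 / (p * t))) := by
        rw [Real.rpow_sub_one ht0.ne']; field_simp; ring
      rw [h2]
      exact mul_le_mul_of_nonneg_left hb (by positivity)
    have h3 : sigmAlpha p (k + 1) = 1 / sigmParamA p * t ^ (p - 1) := rfl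
    rw [h3]
    have ha : 0 < 1 / sigmParamA p := one_div_pos.2 (sigmParamA_pos p)
    nlinarith

theorem coefSum_sigmAlpha_pos (hp : 1 ≤ p) (k : ℕ) : 0 < coefSum (sigmAlpha p) k :=
  Finset.sum_pos (fun i _ => sigmAlpha_pos hp i) ⟨0, by simp⟩

/-- B_k is t^(2p-2)/a with t = (k+p)/p ≥ 1, and 2p - 2 ≤ p because p ≤ 2. -/
theorem sigmB_le_coefSum (hp : p ∈ Set.Icc (1 : ℝ) 2) (k : ℕ) :
    sigmB p k ≤ coefSum (sigmAlpha p) k := by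
  refine le_trans ?_ (div_rpow_le_coefSum hp.1 k)
  have ht := one_le_add_div hp.1 k
  have h1 : sigmB p k = 1 / sigmParamA p * (((k : ℝ) + p) / p) ^ (p - 1 + (p - 1)) := by
    rw [Real.rpow_add (by linarith), sigmB, sigmAlpha]
    have := (sigmParamA_pos p).ne'
    field_simp
  rw [h1]
  exact mul_le_mul_of_nonneg_left (Real.rpow_le_rpow_of_exponent_le ht (by linarith [hp.2]))
    (one_div_pos.2 (sigmParamA_pos p)).le

/-- `A_k` dominates the reciprocal of the decay factor `a p^p / (k + p)^p`. -/
theorem le_coefSum_mul (hp : 1 ≤ p) (k : ℕ) {c : ℝ} (hc : 0 ≤ c) :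
    c ≤ coefSum (sigmAlpha p) k * (sigmParamA p * p ^ p * c / ((k : ℝ) + p) ^ p) := by
  have hp0 : 0 < p := by linarith
  have ha := sigmParamA_pos p
  have hk : 0 < ((k : ℝ) + p) ^ p := Real.rpow_pos_of_pos (by positivity) _
  have hpp : 0 < p ^ p := Real.rpow_pos_of_pos hp0 _
  calc c = 1 / sigmParamA p * (((k : ℝ) + p) / p) ^ p
        * (sigmParamA p * p ^ p * c / ((k : ℝ) + p) ^ p) := by
        rw [Real.div_rpow (by positivity) hp0.le]; field_simp
    _ ≤ _ := mul_le_mul_of_nonneg_right (div_rpow_le_coefSum hp k) (by positivity)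

theorem sum_sigmAlpha_sq_le (hp : 1 ≤ p) (k : ℕ) :
    ∑ i ∈ Finset.range (k + 1), sigmAlpha p i ^ 2
      ≤ sigmAlpha p k * coefSum (sigmAlpha p) k := by
  rw [coefSum, Finset.mul_sum]
  refine Finset.sum_le_sum fun i hi => ?_
  rw [sq]
  exact mul_le_mul_of_nonneg_right
    (sigmAlpha_mono hp (Nat.lt_succ_iff.1 (Finset.mem_range.1 hi))) (sigmAlpha_pos hp i).le

theorem sum_sigmB_le (hp : 1 ≤ p) (k : ℕ) :
    ∑ i ∈ Finset.range (k + 1), sigmB p i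
      ≤ coefSum (sigmAlpha p) k * (((k : ℝ) + p) / p) ^ (p - 1) := by
  simp only [sigmB]
  rw [← Finset.mul_sum, ← sigmParamA_mul_sigmAlpha]
  nlinarith [sum_sigmAlpha_sq_le hp k, sigmParamA_pos p]

theorem sigmAlpha_le_coefSum_mul (hp : 1 ≤ p) (k : ℕ) :
    sigmAlpha p k ≤ coefSum (sigmAlpha p) k * (p / ((k : ℝ) + p)) := by
  have hp0 : 0 < p := by linarith
  have h1 : sigmAlpha p k
      = 1 / sigmParamA p * (((k : ℝ) + p) / p) ^ p * (p / ((k : ℝ) + p)) := by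
    rw [sigmAlpha, Real.rpow_sub_one (by positivity)]
    field_simp
  rw [h1]
  exact mul_le_mul_of_nonneg_right (div_rpow_le_coefSum hp k) (by positivity)

variable {L σ R : ℝ}

theorem sigmBeta_sub (L σ R p : ℝ) (i : ℕ) : sigmBeta L σ R p i - L
    = sigmParamB p * σ / R * ((i : ℝ) + p + 1) ^ ((2 * p - 1) / 2) := by
  rw [sigmBeta]; ring

theorem lt_sigmBeta (hp : 1 ≤ p) (hσ : 0 < σ) (hR : 0 < R) (i : ℕ) : L < sigmBeta L σ R p i := by
  rw [← sub_pos, sigmBeta_sub]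
  have := sigmParamB_pos hp
  have : 0 < ((i : ℝ) + p + 1) ^ ((2 * p - 1) / 2) := Real.rpow_pos_of_pos (by positivity) _
  positivity

theorem sigmBeta_mono (hp : 1 ≤ p) (hσ : 0 < σ) (hR : 0 < R) : Monotone (sigmBeta L σ R p) := by
  intro i j hij
  have := sigmParamB_pos hp
  have hij' : (i : ℝ) ≤ j := by exact_mod_cast hij
  have h : ((i : ℝ) + p + 1) ^ ((2 * p - 1) / 2) ≤ ((j : ℝ) + p + 1) ^ ((2 * p - 1) / 2) :=
    Real.rpow_le_rpow (by positivity) (by linarith) (by linarith)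
  rw [sigmBeta, sigmBeta]
  gcongr

/-- This fixes a: i+p+2 ≤ 2(i+p+1), so one step multiplies β by at most 2^((2p-1)/2) = a. -/
theorem sigmAlpha_sq_mul_sigmBeta_le (hp : 1 ≤ p) (hL : 0 ≤ L) (hσ : 0 < σ) (hR : 0 < R) (i : ℕ) :
    sigmAlpha p (i + 1) ^ 2 * sigmBeta L σ R p (i + 1)
      ≤ sigmB p (i + 1) * sigmBeta L σ R p i := by
  have ha := one_le_sigmParamA hp
  have hb := sigmParamB_pos hp
  have h1 : (((i + 1 : ℕ) : ℝ) + p + 1) ^ ((2 * p - 1) / 2)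
      ≤ sigmParamA p * ((i : ℝ) + p + 1) ^ ((2 * p - 1) / 2) := by
    rw [sigmParamA, ← Real.mul_rpow two_pos.le (by positivity)]
    refine Real.rpow_le_rpow (by positivity) ?_ (by linarith)
    push_cast
    linarith [i.cast_nonneg (α := ℝ)]
  have h2 : sigmBeta L σ R p (i + 1) ≤ sigmParamA p * sigmBeta L σ R p i := by
    rw [sigmBeta, sigmBeta]
    have h3 : 0 < sigmParamB p * σ / R := by positivity
    nlinarith
  rw [sigmB]
  nlinarith [sq_nonneg (sigmAlpha p (i + 1))]

/-- Telescoping of N^(q-1) ≤ 2N^q - 2(N-1)^q, which amounts to (1 - 1/N)^q ≤ 1 - 1/(2N): Bernoulli's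
inequality at exponent 1/2. -/
theorem sum_rpow_sub_one_le {q c : ℝ} (hq : 1 / 2 ≤ q) (hc : 0 ≤ c) (k : ℕ) :
    ∑ i ∈ Finset.range (k + 1), ((i : ℝ) + c + 1) ^ (q - 1) ≤ 2 * ((k : ℝ) + c + 1) ^ q := by
  have hstep (N : ℝ) (hN : 1 ≤ N) : 2 * (N - 1) ^ q + N ^ (q - 1) ≤ 2 * N ^ q := by
    have hN0 : 0 < N := by linarith
    have h1 : N - 1 = N * (1 + -(1 / N)) := by field_simp; ring
    have hle : 1 / N ≤ 1 := by rw [div_le_one hN0]; exact hN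
    have h2 : (1 + -(1 / N)) ^ q ≤ 1 + 1 / 2 * -(1 / N) := by
      refine le_trans ?_ (rpow_one_add_le_one_add_mul_self (p := 1 / 2) (by linarith)
        (by norm_num) (by norm_num))
      have h0 : 0 ≤ 1 + -(1 / N) := by linarith
      exact Real.rpow_le_rpow_of_exponent_ge' h0 (by linarith [one_div_pos.2 hN0]) (by norm_num) hq
    rw [h1, Real.mul_rpow hN0.le (by linarith), Real.rpow_sub_one hN0.ne']
    have h3 := mul_le_mul_of_nonneg_left h2 (Real.rpow_nonneg hN0.le q)
    have h4 : N ^ q * (1 + 1 / 2 * -(1 / N)) = N ^ q - N ^ q / N / 2 := by ring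
    linarith
  induction k with
  | zero =>
    have h := hstep (c + 1) (by linarith)
    have h' : 0 ≤ (c + 1 - 1) ^ q := Real.rpow_nonneg (by linarith) _
    simp only [zero_add, Finset.sum_range_one, Nat.cast_zero]
    linarith
  | succ k ih =>
    rw [Finset.sum_range_succ]
    have h := hstep (((k + 1 : ℕ) : ℝ) + c + 1) (by push_cast; linarith [k.cast_nonneg (α := ℝ)])
    have h1 : ((k + 1 : ℕ) : ℝ) + c + 1 - 1 = (k : ℝ) + c + 1 := by push_cast; ring
    rw [h1] at h
    linarith

theorem sigmB_div_le (hp : 1 ≤ p) (hσ : 0 < σ) (hR : 0 < R) (i : ℕ) :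
    sigmB p i / (2 * (sigmBeta L σ R p i - L))
      ≤ R / (2 * sigmParamA p * sigmParamB p * σ * (p ^ (p - 1)) ^ 2)
        * ((i : ℝ) + p + 1) ^ ((2 * p - 1) / 2 - 1) := by
  have hp0 : 0 < p := by linarith
  have ha := sigmParamA_pos p
  have hb := sigmParamB_pos hp
  have hM : 0 < (i : ℝ) + p + 1 := by positivity
  have hMq : 0 < ((i : ℝ) + p + 1) ^ ((2 * p - 1) / 2) := Real.rpow_pos_of_pos hM _
  have hpp : 0 < p ^ (p - 1) := Real.rpow_pos_of_pos hp0 _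
  have h1 : ((i : ℝ) + p) ^ (p - 1) ≤ ((i : ℝ) + p + 1) ^ (p - 1) :=
    Real.rpow_le_rpow (by positivity) (by linarith) (by linarith)
  have h2 : (((i : ℝ) + p) ^ (p - 1)) ^ 2
      ≤ ((i : ℝ) + p + 1) ^ ((2 * p - 1) / 2 - 1) * ((i : ℝ) + p + 1) ^ ((2 * p - 1) / 2) := by
    have h3 : ((i : ℝ) + p + 1) ^ ((2 * p - 1) / 2 - 1) * ((i : ℝ) + p + 1) ^ ((2 * p - 1) / 2)
        = (((i : ℝ) + p + 1) ^ (p - 1)) ^ 2 := by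
      rw [← Real.rpow_add hM, sq, ← Real.rpow_add hM]; congr 1; ring
    rw [h3]
    have : 0 ≤ ((i : ℝ) + p) ^ (p - 1) := Real.rpow_nonneg (by positivity) _
    gcongr
  rw [sigmBeta_sub, sigmB, sigmAlpha, Real.div_rpow (by positivity) hp0.le]
  calc _ = R / (2 * sigmParamA p * sigmParamB p * σ * (p ^ (p - 1)) ^ 2)
        * ((((i : ℝ) + p) ^ (p - 1)) ^ 2 / ((i : ℝ) + p + 1) ^ ((2 * p - 1) / 2)) := by
        field_simp
    _ ≤ _ := mul_le_mul_of_nonneg_left (by rwa [div_le_iff₀ hMq]) (by positivity)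

theorem sum_sigmB_div_le (hp : p ∈ Set.Icc (1 : ℝ) 2) (hσ : 0 < σ) (hR : 0 < R) (k : ℕ) :
    σ ^ 2 * ∑ i ∈ Finset.range (k + 1), sigmB p i / (2 * (sigmBeta L σ R p i - L))
      ≤ coefSum (sigmAlpha p) k * (σ * R * (2 : ℝ) ^ ((2 * p - 1) / 4) * √p
        * ((k : ℝ) + p + 1) ^ ((2 * p - 1) / 2) / ((k : ℝ) + p) ^ p) := by
  have hp1 := hp.1
  have hp0 : 0 < p := by linarith
  have ha := sigmParamA_pos p
  have hb := sigmParamB_pos hp1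
  have hpp : 0 < p ^ (p - 1) := Real.rpow_pos_of_pos hp0 _
  have hppp : 0 < p ^ p := Real.rpow_pos_of_pos hp0 _
  have hM : 0 < ((k : ℝ) + p + 1) ^ ((2 * p - 1) / 2) := Real.rpow_pos_of_pos (by positivity) _
  set M := ((k : ℝ) + p + 1) ^ ((2 * p - 1) / 2) with hMdef
  have hc : σ ^ 2 * ∑ i ∈ Finset.range (k + 1), sigmB p i / (2 * (sigmBeta L σ R p i - L))
      ≤ σ * R * M / (sigmParamA p * sigmParamB p * (p ^ (p - 1)) ^ 2) := by
    have h1 : ∑ i ∈ Finset.range (k + 1), sigmB p i / (2 * (sigmBeta L σ R p i - L))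
        ≤ R / (2 * sigmParamA p * sigmParamB p * σ * (p ^ (p - 1)) ^ 2) * (2 * M) := by
      refine (Finset.sum_le_sum fun i _ => sigmB_div_le hp1 hσ hR i).trans ?_
      rw [← Finset.mul_sum]
      exact mul_le_mul_of_nonneg_left (sum_rpow_sub_one_le (by linarith) hp0.le k) (by positivity)
    refine (mul_le_mul_of_nonneg_left h1 (sq_nonneg σ)).trans_eq ?_
    field_simp
  have h4 := sigmParamB_sq_mul_sigmParamA hp1
  have h5 := sigmParamB_mul_sigmParamA hp1
  have h6 : 2 ≤ sigmParamB p ^ 2 * sigmParamA p * (p ^ (p - 1)) ^ 2 := by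
    have : sigmParamB p ^ 2 * sigmParamA p * (p ^ (p - 1)) ^ 2 = 4 / p := by
      rw [eq_div_iff hp0.ne', h4]
    rw [this, le_div_iff₀ hp0]
    linarith [hp.2]
  have h7 : σ * R * M / (sigmParamA p * sigmParamB p * (p ^ (p - 1)) ^ 2)
      ≤ sigmParamB p * σ * R * M / 2 := by
    rw [div_le_div_iff₀ (by positivity) two_pos]
    have h8 := mul_le_mul_of_nonneg_left h6 (show 0 ≤ σ * R * M by positivity)
    linarith
  refine (hc.trans h7).trans ((le_coefSum_mul hp1 k (by positivity)).trans_eq ?_)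
  congr 2
  calc _ = sigmParamB p * sigmParamA p * p ^ p * (σ * R * M / 2) := by ring
    _ = _ := by rw [h5]; ring

theorem sigmBeta_mul_sq_le (hp : 1 ≤ p) (hL : 0 ≤ L) (hσ : 0 < σ) (hR : 0 < R) (k : ℕ) :
    sigmBeta L σ R p k * (R ^ 2 / 2)
      ≤ coefSum (sigmAlpha p) k * (L * R ^ 2 * p ^ p * (2 : ℝ) ^ ((2 * p - 3) / 2)
          / ((k : ℝ) + p) ^ p
        + σ * R * (2 : ℝ) ^ ((2 * p - 1) / 4) * √p
          * ((k : ℝ) + p + 1) ^ ((2 * p - 1) / 2) / ((k : ℝ) + p) ^ p) := by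
  have hp0 : 0 < p := by linarith
  have hb := sigmParamB_pos hp
  have hM : 0 < ((k : ℝ) + p + 1) ^ ((2 * p - 1) / 2) := Real.rpow_pos_of_pos (by positivity) _
  have h1 := le_coefSum_mul hp k (c := L * R ^ 2 / 2) (by positivity)
  have h2 := le_coefSum_mul hp k
    (c := sigmParamB p * σ * R * ((k : ℝ) + p + 1) ^ ((2 * p - 1) / 2) / 2) (by positivity)
  have h3 : sigmBeta L σ R p k * (R ^ 2 / 2) = L * R ^ 2 / 2
      + sigmParamB p * σ * R * ((k : ℝ) + p + 1) ^ ((2 * p - 1) / 2) / 2 := by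
    rw [sigmBeta]; field_simp
  rw [h3, mul_add]
  refine add_le_add (h1.trans_eq ?_) (h2.trans_eq ?_)
  · rw [← two_rpow_mul_two]; congr 2; ring
  · congr 2
    calc _ = sigmParamB p * sigmParamA p * p ^ p
          * (σ * R * ((k : ℝ) + p + 1) ^ ((2 * p - 1) / 2) / 2) := by ring
      _ = _ := by rw [sigmParamB_mul_sigmParamA hp]; ring

/-- The bound on the gap, once the squared noise and the martingale are controlled. -/
theorem gap_le_of_noise_le (hp : p ∈ Set.Icc (1 : ℝ) 2) (hL : 0 ≤ L) (hσ : 0 < σ) (hR : 0 < R)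
    {δ D Om gap dx V M : ℝ} (hδ : 0 ≤ δ) (hD : 0 ≤ D) (hOm : 0 ≤ Om) (hdx : dx ≤ R ^ 2 / 2)
    (k : ℕ)
    (hgap : coefSum (sigmAlpha p) k * gap ≤ sigmBeta L σ R p k * dx
      + (∑ i ∈ Finset.range (k + 1), sigmB p i) * δ + V + M)
    (hV : V ≤ (1 + Om) * (σ ^ 2 *
      ∑ i ∈ Finset.range (k + 1), sigmB p i / (2 * (sigmBeta L σ R p i - L))))
    (hM : M ≤ D * σ * √(24 * Om * ∑ i ∈ Finset.range (k + 1), sigmAlpha p i ^ 2)) :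
    gap ≤ L * R ^ 2 * p ^ p * (2 : ℝ) ^ ((2 * p - 3) / 2) / ((k : ℝ) + p) ^ p
          + (1 + Om) * σ * R * (2 : ℝ) ^ ((3 + 2 * p) / 4) * √p
              * ((k : ℝ) + p + 2) ^ (p - 1 / 2) / ((k : ℝ) + p) ^ p
          + (2 : ℝ) ^ (2 * p - 1) * ((((k : ℝ) + p) / p) ^ (p - 1) + 1) * δ
          + 2 * D * σ * √(6 * Om * p) / √((k : ℝ) + p) := by
  have hp1 := hp.1
  have hp0 : 0 < p := by linarith
  have hA := coefSum_sigmAlpha_pos hp1 k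
  have hkp : 0 < (k : ℝ) + p := by positivity
  set A := coefSum (sigmAlpha p) k with hAdef
  have h1 := mul_le_mul_of_nonneg_left hdx (hL.trans (lt_sigmBeta (L := L) hp1 hσ hR k).le)
  have h2 := sigmBeta_mul_sq_le (L := L) hp1 hL hσ hR k
  have h3 := sum_sigmB_div_le (L := L) hp hσ hR k
  set W := σ * R * (2 : ℝ) ^ ((2 * p - 1) / 4) * √p
        * ((k : ℝ) + p + 1) ^ ((2 * p - 1) / 2) / ((k : ℝ) + p) ^ p with hWdef
  have hW : 0 ≤ W := by positivity
  have hδ' := mul_le_mul_of_nonneg_right (sum_sigmB_le hp1 k) hδ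
  set T := (((k : ℝ) + p) / p) ^ (p - 1) with hT
  have hT0 : 0 ≤ T := Real.rpow_nonneg (by positivity) _
  have h4 : T * δ ≤ (2 : ℝ) ^ (2 * p - 1) * (T + 1) * δ := by
    have : (1 : ℝ) ≤ (2 : ℝ) ^ (2 * p - 1) := Real.one_le_rpow one_le_two (by linarith)
    refine mul_le_mul_of_nonneg_right ?_ hδ
    nlinarith
  have h5 : M ≤ A * (2 * D * σ * √(6 * Om * p) / √((k : ℝ) + p)) := by
    refine hM.trans ?_
    -- Monotonicity of α gives Σ α_i² ≤ α_k A_k, and α_k ≤ A_k p/(k+p): the source of the rate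
    -- 1/√(k+p).
    have h6 : ∑ i ∈ Finset.range (k + 1), sigmAlpha p i ^ 2 ≤ A ^ 2 * (p / ((k : ℝ) + p)) := by
      refine (sum_sigmAlpha_sq_le hp1 k).trans ?_
      have := sigmAlpha_le_coefSum_mul hp1 k
      rw [← hAdef] at this ⊢
      nlinarith
    have h7 : √(24 * Om * ∑ i ∈ Finset.range (k + 1), sigmAlpha p i ^ 2)
        ≤ A * (2 * (√(6 * Om * p) / √((k : ℝ) + p))) := by
      refine Real.sqrt_le_iff.2 ⟨by positivity, ?_⟩
      rw [mul_pow, mul_pow, div_pow, Real.sq_sqrt (by positivity), Real.sq_sqrt hkp.le]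
      calc _ ≤ 24 * Om * (A ^ 2 * (p / ((k : ℝ) + p))) :=
            mul_le_mul_of_nonneg_left h6 (by positivity)
        _ = _ := by ring
    refine (mul_le_mul_of_nonneg_left h7 (mul_nonneg hD hσ.le)).trans_eq ?_
    ring
  have h8 : 2 * (1 + Om) * W ≤ (1 + Om) * σ * R * (2 : ℝ) ^ ((3 + 2 * p) / 4) * √p
              * ((k : ℝ) + p + 2) ^ (p - 1 / 2) / ((k : ℝ) + p) ^ p := by
    have h9 : ((k : ℝ) + p + 1) ^ ((2 * p - 1) / 2) ≤ ((k : ℝ) + p + 2) ^ (p - 1 / 2) := by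
      rw [show (2 * p - 1) / 2 = p - 1 / 2 by ring]
      exact Real.rpow_le_rpow (by positivity) (by linarith) (by linarith)
    have h10 : (2 : ℝ) ^ ((3 + 2 * p) / 4) = 2 ^ ((2 * p - 1) / 4) * 2 := by
      rw [← Real.rpow_add_one two_ne_zero]; congr 1; ring
    rw [h10, hWdef]
    calc _ = (1 + Om) * σ * R * (2 ^ ((2 * p - 1) / 4) * 2) * √p
          * ((k : ℝ) + p + 1) ^ ((2 * p - 1) / 2) / ((k : ℝ) + p) ^ p := by ring
      _ ≤ _ := by gcongr
  have h11 : V ≤ A * ((1 + Om) * W) := by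
    refine hV.trans ((mul_le_mul_of_nonneg_left h3 (by linarith)).trans_eq ?_)
    ring
  have h12 : 0 ≤ Om * W := mul_nonneg hOm hW
  refine le_of_mul_le_mul_left ?_ hA
  -- One W comes from β_k d(x*), and 1 + Ω of them from the squared noise.
  have h13 : (2 + Om) * W ≤ 2 * (1 + Om) * W := by linarith
  have h14 := mul_le_mul_of_nonneg_left (h13.trans h8) hA.le
  have h15 := mul_le_mul_of_nonneg_left h4 hA.le
  linarith

/-- The explicit bound dominates the bound with the exact dependence on `p`. -/
theorem exact_bound_le_simple_bound (hp : p ∈ Set.Icc (1 : ℝ) 2) (hL : 0 ≤ L) (hσ : 0 < σ)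
    (hR : 0 < R) {δ D Om : ℝ} (hδ : 0 ≤ δ) (hD : 0 ≤ D) (hOm : 0 ≤ Om) {k : ℕ} (hk : 1 ≤ k) :
    L * R ^ 2 * p ^ p * (2 : ℝ) ^ ((2 * p - 3) / 2) / ((k : ℝ) + p) ^ p
          + (1 + Om) * σ * R * (2 : ℝ) ^ ((3 + 2 * p) / 4) * √p
              * ((k : ℝ) + p + 2) ^ (p - 1 / 2) / ((k : ℝ) + p) ^ p
          + (2 : ℝ) ^ (2 * p - 1) * ((((k : ℝ) + p) / p) ^ (p - 1) + 1) * δ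
          + 2 * D * σ * √(6 * Om * p) / √((k : ℝ) + p)
      ≤ 4 * √2 * L * R ^ 2 / (k : ℝ) ^ p
          + 16 * √2 * (1 + Om) * σ * R / √(k : ℝ)
          + 48 * (k : ℝ) ^ (p - 1) * δ
          + 4 * √3 * D * σ * √Om / √(k : ℝ) := by
  obtain ⟨hp1, hp2⟩ := hp
  have hp0 : 0 < p := by linarith
  have hk1 : (1 : ℝ) ≤ k := by exact_mod_cast hk
  have hk0 : (0 : ℝ) < k := by linarith
  have hN : 0 < (k : ℝ) + p := by positivity
  have hs2 : √2 = (2 : ℝ) ^ (1 / 2 : ℝ) := Real.sqrt_eq_rpow 2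
  refine add_le_add (add_le_add (add_le_add ?_ ?_) ?_) ?_
  · have h1 : p ^ p ≤ 4 := by
      calc p ^ p ≤ 2 ^ p := Real.rpow_le_rpow hp0.le hp2 hp0.le
        _ ≤ 2 ^ (2 : ℝ) := Real.rpow_le_rpow_of_exponent_le one_le_two hp2
        _ = 4 := by norm_num
    have h2 : (2 : ℝ) ^ ((2 * p - 3) / 2) ≤ √2 := by
      rw [hs2]; exact Real.rpow_le_rpow_of_exponent_le one_le_two (by linarith)
    have h3 : (k : ℝ) ^ p ≤ ((k : ℝ) + p) ^ p := Real.rpow_le_rpow hk0.le (by linarith) hp0.le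
    have h4 : 0 < (k : ℝ) ^ p := Real.rpow_pos_of_pos hk0 _
    calc _ ≤ L * R ^ 2 * 4 * √2 / (k : ℝ) ^ p := by gcongr
      _ = _ := by ring
  · have h1 : (2 : ℝ) ^ ((3 + 2 * p) / 4) * √p * (2 : ℝ) ^ (p - 1 / 2) ≤ 16 * √2 := by
      have h2 : (2 : ℝ) ^ ((3 + 2 * p) / 4) ≤ 2 ^ (2 : ℝ) :=
        Real.rpow_le_rpow_of_exponent_le one_le_two (by linarith)
      have h3 : (2 : ℝ) ^ (p - 1 / 2) ≤ 2 ^ (2 : ℝ) :=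
        Real.rpow_le_rpow_of_exponent_le one_le_two (by linarith)
      have h4 : √p ≤ √2 := Real.sqrt_le_sqrt hp2
      calc _ ≤ (2 : ℝ) ^ (2 : ℝ) * √2 * 2 ^ (2 : ℝ) := by gcongr
        _ = _ := by norm_num; ring
    -- Here k ≥ 1 and p ≥ 1 give k + p + 2 ≤ 2(k + p).
    have h5 : ((k : ℝ) + p + 2) ^ (p - 1 / 2)
        ≤ (2 : ℝ) ^ (p - 1 / 2) * ((k : ℝ) + p) ^ (p - 1 / 2) := by
      rw [← Real.mul_rpow two_pos.le hN.le]
      exact Real.rpow_le_rpow (by positivity) (by linarith) (by linarith)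
    have h6 : ((k : ℝ) + p) ^ (p - 1 / 2) / ((k : ℝ) + p) ^ p = 1 / √((k : ℝ) + p) := by
      rw [Real.rpow_sub hN, Real.sqrt_eq_rpow]
      have : ((k : ℝ) + p) ^ p ≠ 0 := (Real.rpow_pos_of_pos hN _).ne'
      field_simp
    calc _ ≤ (1 + Om) * σ * R * (2 : ℝ) ^ ((3 + 2 * p) / 4) * √p
              * ((2 : ℝ) ^ (p - 1 / 2) * ((k : ℝ) + p) ^ (p - 1 / 2)) / ((k : ℝ) + p) ^ p := by
          gcongr
      _ = (1 + Om) * σ * R * ((2 : ℝ) ^ ((3 + 2 * p) / 4) * √p * (2 : ℝ) ^ (p - 1 / 2))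
            * (((k : ℝ) + p) ^ (p - 1 / 2) / ((k : ℝ) + p) ^ p) := by ring
      _ ≤ (1 + Om) * σ * R * (16 * √2) * (1 / √(k : ℝ)) := by
          rw [h6]
          have : √(k : ℝ) ≤ √((k : ℝ) + p) := Real.sqrt_le_sqrt (by linarith)
          gcongr
      _ = _ := by ring
  · have h1 : (2 : ℝ) ^ (2 * p - 1) ≤ 8 := by
      calc (2 : ℝ) ^ (2 * p - 1) ≤ 2 ^ (3 : ℝ) :=
            Real.rpow_le_rpow_of_exponent_le one_le_two (by linarith)
        _ = 8 := by norm_num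
    have h2 : (((k : ℝ) + p) / p) ^ (p - 1) ≤ 2 * (k : ℝ) ^ (p - 1) := by
      have h3 : ((k : ℝ) + p) / p ≤ 2 * k := by
        rw [div_le_iff₀ hp0]; nlinarith
      calc _ ≤ (2 * (k : ℝ)) ^ (p - 1) :=
            Real.rpow_le_rpow (by positivity) h3 (by linarith)
        _ = 2 ^ (p - 1) * (k : ℝ) ^ (p - 1) := Real.mul_rpow two_pos.le hk0.le
        _ ≤ 2 ^ (1 : ℝ) * (k : ℝ) ^ (p - 1) := by
            gcongr
            · exact one_le_two
            · linarith
        _ = _ := by norm_num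
    have h4 : 1 ≤ (k : ℝ) ^ (p - 1) := Real.one_le_rpow hk1 (by linarith)
    have h5 : (0 : ℝ) ≤ 2 ^ (2 * p - 1) := by positivity
    refine mul_le_mul_of_nonneg_right ?_ hδ
    nlinarith
  · have h1 : √(6 * Om * p) ≤ 2 * √3 * √Om := by
      refine Real.sqrt_le_iff.2 ⟨by positivity, ?_⟩
      rw [mul_pow, mul_pow, Real.sq_sqrt (by norm_num), Real.sq_sqrt hOm]
      nlinarith
    have h2 : √(k : ℝ) ≤ √((k : ℝ) + p) := Real.sqrt_le_sqrt (by linarith)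
    have h3 : 0 < √(k : ℝ) := Real.sqrt_pos.2 hk0
    calc _ ≤ 2 * D * σ * (2 * √3 * √Om) / √(k : ℝ) := by gcongr
      _ = _ := by ring

end Parameters

/-! ### From the light tail to sub-Gaussian moments -/

theorem exp_le_add_exp_sq (x : ℝ) : Real.exp x ≤ x + Real.exp (x ^ 2) := by
  have h1 := Real.add_one_le_exp (x ^ 2)
  rcases le_total (|x|) 1 with hx | hx
  · have := (abs_le.1 (Real.abs_exp_sub_one_sub_id_le hx)).2
    linarith
  · rcases le_total 0 x with h0 | h0
    · rw [abs_of_nonneg h0] at hx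
      have : Real.exp x ≤ Real.exp (x ^ 2) := Real.exp_le_exp.2 (by nlinarith)
      linarith
    · rw [abs_of_nonpos h0] at hx
      have : Real.exp x ≤ 1 := Real.exp_le_one_iff.2 h0
      nlinarith

/-- Convexity of exp between y - 1 and 0, multiplied by e^r. It is a pointwise form of Jensen's
inequality: if 𝔼 e^y ≤ e, the right side has mean at most e^r. -/
theorem exp_mul_le_of_mem_Icc {r : ℝ} (hr : r ∈ Set.Icc (0 : ℝ) 1) (y : ℝ) :
    Real.exp (r * y) ≤ Real.exp r * (1 - r) + Real.exp r * r * Real.exp (-1) * Real.exp y := by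
  have h := convexOn_exp.2 (Set.mem_univ (y - 1)) (Set.mem_univ 0) hr.1 (sub_nonneg.2 hr.2)
    (by ring)
  simp only [smul_eq_mul, mul_zero, add_zero, Real.exp_zero, mul_one] at h
  have h1 : Real.exp (r * y) = Real.exp r * Real.exp (r * (y - 1)) := by
    rw [← Real.exp_add]; congr 1; ring
  have h2 : Real.exp (y - 1) = Real.exp (-1) * Real.exp y := by
    rw [← Real.exp_add]; congr 1; ring
  rw [h2] at h
  rw [h1]
  have := mul_le_mul_of_nonneg_left h (Real.exp_pos r).le
  linarith

/-- A centered variable `X` with `𝔼 exp (X² / τ²) ≤ e` is sub-Gaussian. -/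
theorem lintegral_exp_mul_le {Ξ : Type*} [MeasurableSpace Ξ] {ν : Measure Ξ}
    [IsProbabilityMeasure ν] {X : Ξ → ℝ} (hX : Measurable X) (hXi : Integrable X ν)
    (hX0 : ∫ s, X s ∂ν = 0) {τ : ℝ} (hτ : 0 < τ)
    (htail : ∫⁻ s, ENNReal.ofReal (Real.exp (X s ^ 2 / τ ^ 2)) ∂ν ≤ ENNReal.ofReal (Real.exp 1))
    (l : ℝ) : ∫⁻ s, ENNReal.ofReal (Real.exp (l * X s)) ∂ν
      ≤ ENNReal.ofReal (Real.exp (l ^ 2 * τ ^ 2)) := by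
  have hm : Measurable fun s => Real.exp (X s ^ 2 / τ ^ 2) := by fun_prop
  have hint : Integrable (fun s => Real.exp (X s ^ 2 / τ ^ 2)) ν := by
    refine ⟨hm.aestronglyMeasurable, ?_⟩
    rw [hasFiniteIntegral_iff_ofReal (Filter.Eventually.of_forall fun s => (Real.exp_pos _).le)]
    exact htail.trans_lt ENNReal.ofReal_lt_top
  have hle : ∫ s, Real.exp (X s ^ 2 / τ ^ 2) ∂ν ≤ Real.exp 1 := by
    rw [← ofReal_integral_eq_lintegral_ofReal hint
      (Filter.Eventually.of_forall fun s => (Real.exp_pos _).le)] at htail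
    exact (ENNReal.ofReal_le_ofReal_iff (Real.exp_pos 1).le).1 htail
  -- It suffices to find a pointwise majorant of this shape: its linear part has mean zero.
  have key (l' c₀ c₁ : ℝ) (hc₁ : 0 ≤ c₁) (hc : c₀ + c₁ * Real.exp 1 ≤ Real.exp (l ^ 2 * τ ^ 2))
      (hpt : ∀ s, Real.exp (l * X s) ≤ l' * X s + (c₀ + c₁ * Real.exp (X s ^ 2 / τ ^ 2))) :
      ∫⁻ s, ENNReal.ofReal (Real.exp (l * X s)) ∂ν
        ≤ ENNReal.ofReal (Real.exp (l ^ 2 * τ ^ 2)) := by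
    have hi1 : Integrable (fun s => l' * X s) ν := hXi.const_mul l'
    have hi3 : Integrable (fun s => c₁ * Real.exp (X s ^ 2 / τ ^ 2)) ν := hint.const_mul c₁
    have hi2 : Integrable (fun s => c₀ + c₁ * Real.exp (X s ^ 2 / τ ^ 2)) ν :=
      (integrable_const c₀).add hi3
    have hi12 : Integrable (fun s => l' * X s + (c₀ + c₁ * Real.exp (X s ^ 2 / τ ^ 2))) ν :=
      hi1.add hi2
    refine (lintegral_mono fun s => ENNReal.ofReal_le_ofReal (hpt s)).trans ?_
    rw [← ofReal_integral_eq_lintegral_ofReal hi12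
      (Filter.Eventually.of_forall fun s => (Real.exp_pos _).le.trans (hpt s))]
    refine ENNReal.ofReal_le_ofReal ?_
    rw [integral_add hi1 hi2, integral_const_mul, hX0, integral_add (integrable_const c₀) hi3,
      integral_const_mul, integral_const]
    simp only [probReal_univ, smul_eq_mul, one_mul, mul_zero, zero_add]
    nlinarith
  have hexp : Real.exp (-1) * Real.exp 1 = 1 := by rw [← Real.exp_add]; simp
  rcases le_total (l ^ 2 * τ ^ 2) 1 with hr | hr
  · have hr' : l ^ 2 * τ ^ 2 ∈ Set.Icc (0 : ℝ) 1 := ⟨by positivity, hr⟩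
    refine key l (Real.exp (l ^ 2 * τ ^ 2) * (1 - l ^ 2 * τ ^ 2))
      (Real.exp (l ^ 2 * τ ^ 2) * (l ^ 2 * τ ^ 2) * Real.exp (-1)) ?_ ?_ fun s => (exp_le_add_exp_sq (l * X s)).trans
      (add_le_add_right ?_ _)
    · positivity
    · rw [mul_assoc, hexp]; apply le_of_eq; ring
    · have h := exp_mul_le_of_mem_Icc hr' (X s ^ 2 / τ ^ 2)
      have h1 : l ^ 2 * τ ^ 2 * (X s ^ 2 / τ ^ 2) = (l * X s) ^ 2 := by field_simp
      rwa [h1] at h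
  -- For r ≥ 1 centering is not needed: lX ≤ r/2 + X²/(2τ²) yields exp(r/2 + 1/2) ≤ exp r.
  · set r := l ^ 2 * τ ^ 2 with hrdef
    refine key 0 (Real.exp (r / 2) * (Real.exp (1 / 2) * (1 - 1 / 2)))
      (Real.exp (r / 2) * (Real.exp (1 / 2) * (1 / 2) * Real.exp (-1))) (by positivity) ?_
      fun s => ?_
    · calc _ = Real.exp (r / 2) * Real.exp (1 / 2)
            * (1 / 2 + 1 / 2 * (Real.exp (-1) * Real.exp 1)) := by ring
        _ = Real.exp (r / 2 + 1 / 2) := by rw [hexp, Real.exp_add]; ring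
        _ ≤ Real.exp r := Real.exp_le_exp.2 (by linarith)
    · have h1 : l * X s ≤ r / 2 + 1 / 2 * (X s ^ 2 / τ ^ 2) := by
        have h2 : r / 2 + 1 / 2 * (X s ^ 2 / τ ^ 2) - l * X s = (l * τ - X s / τ) ^ 2 / 2 := by
          rw [hrdef]; field_simp; ring
        have : 0 ≤ (l * τ - X s / τ) ^ 2 / 2 := by positivity
        linarith
      have h3 := exp_mul_le_of_mem_Icc (r := 1 / 2) ⟨by norm_num, by norm_num⟩ (X s ^ 2 / τ ^ 2)
      have h4 := mul_le_mul_of_nonneg_left h3 (Real.exp_pos (r / 2)).le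
      refine (Real.exp_le_exp.2 h1).trans ?_
      rw [Real.exp_add]
      linarith

/-! ### Filtration, tail bounds and martingale moments -/

/-- The information carried by `ξ 0, …, ξ (k - 1)`. -/
@[reducible] def pastSigma {S Ξ : Type*} [MeasurableSpace Ξ] (ξ : ℕ → S → Ξ) (k : ℕ) :
    MeasurableSpace S :=
  ⨆ i ∈ Set.Iio k, MeasurableSpace.comap (ξ i) inferInstance

theorem measurable_pastSigma {S Ξ : Type*} [MeasurableSpace Ξ] (ξ : ℕ → S → Ξ)
    {i k : ℕ} (hik : i < k) :
    Measurable[pastSigma ξ k] (ξ i) :=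
  Measurable.of_comap_le (le_iSup₂_of_le (f := fun i (_ : i ∈ Set.Iio k) =>
    MeasurableSpace.comap (ξ i) inferInstance) i hik le_rfl)

theorem pastSigma_mono {S Ξ : Type*} [MeasurableSpace Ξ] (ξ : ℕ → S → Ξ) :
    Monotone (pastSigma ξ) := fun _ _ hij =>
  biSup_mono fun _ hl => lt_of_lt_of_le hl hij

section Tail

variable {S : Type*} [MeasurableSpace S] {P : Measure S}

theorem measure_lt_le_of_lintegral_exp_le {X : S → ℝ} (hX : Measurable X) {t c : ℝ}
    (h : ∫⁻ ω, ENNReal.ofReal (Real.exp (X ω)) ∂P ≤ ENNReal.ofReal (Real.exp c)) :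
    P {ω | t < X ω} ≤ ENNReal.ofReal (Real.exp (c - t)) := by
  have hm : Measurable fun ω => ENNReal.ofReal (Real.exp (X ω)) := by fun_prop
  have h1 := (mul_meas_ge_le_lintegral (μ := P) hm (ENNReal.ofReal (Real.exp t))).trans h
  have h2 : P {ω | t < X ω} ≤ P {ω | ENNReal.ofReal (Real.exp t)
      ≤ ENNReal.ofReal (Real.exp (X ω))} :=
    measure_mono fun ω (hω : t < X ω) =>
      ENNReal.ofReal_le_ofReal (Real.exp_le_exp.2 hω.le)
  refine h2.trans ?_
  rw [Real.exp_sub, ENNReal.ofReal_div_of_pos (Real.exp_pos t),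
    ENNReal.le_div_iff_mul_le (Or.inl (by simpa using Real.exp_pos t))
      (Or.inl ENNReal.ofReal_ne_top), mul_comm]
  exact h1

/-- The Chernoff bound for a sub-Gaussian variable. -/
theorem measure_lt_le_of_subgaussian [IsProbabilityMeasure P] {X : S → ℝ} (hX : Measurable X) {v t : ℝ} (hv : 0 < v)
    (ht : 0 ≤ t) (h : ∀ l : ℝ, ∫⁻ ω, ENNReal.ofReal (Real.exp (l * X ω)) ∂P
      ≤ ENNReal.ofReal (Real.exp (l ^ 2 * v))) :
    P {ω | t < X ω} ≤ ENNReal.ofReal (Real.exp (-(t ^ 2 / (4 * v)))) := by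
  rcases ht.eq_or_lt with rfl | ht
  · simpa using prob_le_one
  -- The choice l = t/(2v) minimizes l²v - lt.
  · have hl : 0 < t / (2 * v) := by positivity
    have h1 := measure_lt_le_of_lintegral_exp_le (t := t / (2 * v) * t)
      (hX.const_mul (t / (2 * v))) (h (t / (2 * v)))
    have h2 : (t / (2 * v)) ^ 2 * v - t / (2 * v) * t = -(t ^ 2 / (4 * v)) := by
      field_simp; ring
    rw [h2] at h1
    refine le_trans (measure_mono fun ω (hω : t < X ω) => ?_) h1
    exact mul_lt_mul_of_pos_left hω hl

/-- A tail bound for nonnegative combinations of variables with exponential moments, with no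
independence assumption. -/
theorem measure_sum_lt_le {ι : Type*} (I : Finset ι) {Y : ι → S → ℝ}
    (hY : ∀ i ∈ I, Measurable (Y i)) {c : ι → ℝ} (hc : ∀ i ∈ I, 0 ≤ c i) (hpos : 0 < ∑ i ∈ I, c i)
    (h : ∀ i ∈ I, ∫⁻ ω, ENNReal.ofReal (Real.exp (Y i ω)) ∂P ≤ ENNReal.ofReal (Real.exp 1))
    (Om : ℝ) :
    P {ω | (1 + Om) * ∑ i ∈ I, c i < ∑ i ∈ I, c i * Y i ω} ≤ ENNReal.ofReal (Real.exp (-Om)) := by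
  set C := ∑ i ∈ I, c i with hC
  have hcC : ∀ i ∈ I, 0 ≤ c i / C := fun i hi => div_nonneg (hc i hi) hpos.le
  have hsum : ∑ i ∈ I, c i / C = 1 := by rw [← Finset.sum_div, div_self hpos.ne']
  have hmeas : Measurable fun ω => ∑ i ∈ I, c i / C * Y i ω :=
    Finset.measurable_sum _ fun i hi => (hY i hi).const_mul _
  -- Jensen's inequality with the normalized weights c_i/C; linearity of the integral does the rest,
  -- whatever the joint law.
  have hint : ∫⁻ ω, ENNReal.ofReal (Real.exp (∑ i ∈ I, c i / C * Y i ω)) ∂P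
      ≤ ENNReal.ofReal (Real.exp 1) := by
    calc _ ≤ ∫⁻ ω, ∑ i ∈ I, ENNReal.ofReal (c i / C) * ENNReal.ofReal (Real.exp (Y i ω)) ∂P := by
          refine lintegral_mono fun ω => ?_
          have hj := convexOn_exp.map_sum_le (t := I) (w := fun i => c i / C)
            (p := fun i => Y i ω) hcC hsum fun i _ => Set.mem_univ _
          refine (ENNReal.ofReal_le_ofReal hj).trans_eq ?_
          simp only [smul_eq_mul]
          rw [ENNReal.ofReal_sum_of_nonneg fun i hi => mul_nonneg (hcC i hi) (Real.exp_pos _).le]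
          exact Finset.sum_congr rfl fun i hi => ENNReal.ofReal_mul (hcC i hi)
      _ = ∑ i ∈ I, ENNReal.ofReal (c i / C) * ∫⁻ ω, ENNReal.ofReal (Real.exp (Y i ω)) ∂P := by
          rw [lintegral_finsetSum']
          · refine Finset.sum_congr rfl fun i hi => lintegral_const_mul _ ?_
            have := hY i hi
            fun_prop
          · intro i hi
            have := hY i hi
            fun_prop
      _ ≤ ∑ i ∈ I, ENNReal.ofReal (c i / C) * ENNReal.ofReal (Real.exp 1) :=
          Finset.sum_le_sum fun i hi => mul_le_mul_right (h i hi) _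
      _ = ENNReal.ofReal (Real.exp 1) := by
          rw [← Finset.sum_mul, ← ENNReal.ofReal_sum_of_nonneg hcC, hsum, ENNReal.ofReal_one,
            one_mul]
  have h1 := measure_lt_le_of_lintegral_exp_le (t := 1 + Om) hmeas hint
  rw [show (1 : ℝ) - (1 + Om) = -Om by ring] at h1
  refine le_trans (measure_mono fun ω hω => ?_) h1
  change (1 + Om) * C < _ at hω
  change 1 + Om < ∑ i ∈ I, c i / C * Y i ω
  have h2 : ∑ i ∈ I, c i / C * Y i ω = (∑ i ∈ I, c i * Y i ω) / C := by
    rw [Finset.sum_div]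
    exact Finset.sum_congr rfl fun i _ => by ring
  rwa [h2, lt_div_iff₀ hpos]

variable {Ξ T : Type*} [MeasurableSpace Ξ] [MeasurableSpace T] {ν : Measure Ξ}

/-- Integrating out a variable that is independent of the past. -/
theorem lintegral_comp_eq_of_indepFun [IsProbabilityMeasure P] [IsProbabilityMeasure ν] {U : S → T} {ζ : S → Ξ}
    (hU : Measurable U) (hζ : Measurable ζ) (hind : IndepFun U ζ P) (hlaw : P.map ζ = ν)
    {Φ : T × Ξ → ENNReal} (hΦ : Measurable Φ) :
    ∫⁻ ω, Φ (U ω, ζ ω) ∂P = ∫⁻ ω, ∫⁻ s, Φ (U ω, s) ∂ν ∂P := by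
  have h := (indepFun_iff_map_prod_eq_prod_map_map hU.aemeasurable hζ.aemeasurable).1 hind
  rw [hlaw] at h
  have : IsProbabilityMeasure (P.map U) := Measure.isProbabilityMeasure_map hU.aemeasurable
  rw [← lintegral_map (f := Φ) (g := fun ω => (U ω, ζ ω)) hΦ (hU.prodMk hζ), h,
    lintegral_prod _ hΦ.aemeasurable, lintegral_map hΦ.lintegral_prod_right' hU]

theorem pastSigma_le {ξ : ℕ → S → Ξ} (hξ : ∀ i, Measurable (ξ i)) (k : ℕ) :
    pastSigma ξ k ≤ (inferInstance : MeasurableSpace S) :=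
  iSup₂_le fun i _ => (hξ i).comap_le

theorem indepFun_of_measurable_pastSigma {ξ : ℕ → S → Ξ} (hξ : ∀ i, Measurable (ξ i))
    (hind : iIndepFun ξ P) {k : ℕ} {U : S → T} (hU : Measurable[pastSigma ξ k] U) :
    IndepFun U (ξ k) P := by
  have h := indep_iSup_of_disjoint (fun i => (hξ i).comap_le) hind.iIndep
    (S := Set.Iio k) (T := {k}) (by simp)
  rw [IndepFun_iff_Indep]
  refine indep_of_indep_of_le_left (m₁ := pastSigma ξ k) ?_ hU.comap_le
  simpa [pastSigma] using h

/-- Sub-Gaussian bound for the exponential moments of a martingale transform of i.i.d. noise. -/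
theorem lintegral_exp_sum_le [IsProbabilityMeasure P] [IsProbabilityMeasure ν] {ξ : ℕ → S → Ξ}
    (hξ : ∀ i, Measurable (ξ i)) (hlaw : ∀ i, P.map (ξ i) = ν) (hind : iIndepFun ξ P)
    {U : ℕ → S → T} (hU : ∀ i, Measurable[pastSigma ξ i] (U i)) {X : T → Ξ → ℝ}
    (hX : Measurable (Function.uncurry X)) {r : ℝ}
    (hmgf : ∀ t l, ∫⁻ s, ENNReal.ofReal (Real.exp (l * X t s)) ∂ν
      ≤ ENNReal.ofReal (Real.exp (l ^ 2 * r))) (c : ℕ → ℝ) (n : ℕ) (l : ℝ) :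
    ∫⁻ ω, ENNReal.ofReal (Real.exp (l * ∑ i ∈ Finset.range n, c i * X (U i ω) (ξ i ω))) ∂P
      ≤ ENNReal.ofReal (Real.exp (l ^ 2 * (r * ∑ i ∈ Finset.range n, c i ^ 2))) := by
  induction n with
  | zero => simp
  | succ n ih =>
    have hM : Measurable[pastSigma ξ n]
        fun ω => ∑ i ∈ Finset.range n, c i * X (U i ω) (ξ i ω) := by
      refine Finset.measurable_sum _ fun i hi => ?_
      have hin := Finset.mem_range.1 hi
      have hUi : Measurable[pastSigma ξ n] (U i) :=
        (hU i).mono (pastSigma_mono ξ hin.le) le_rfl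
      exact (hX.comp (hUi.prodMk (measurable_pastSigma ξ hin))).const_mul _
    set M := fun ω => ∑ i ∈ Finset.range n, c i * X (U i ω) (ξ i ω) with hMdef
    -- The partial sum and the current state are jointly independent of `ξ n`, which is integrated
    -- out with both frozen; this replaces conditional expectation.
    have hMU : Measurable[pastSigma ξ n] fun ω => (M ω, U n ω) := hM.prodMk (hU n)
    let Φ : (ℝ × T) × Ξ → ENNReal := fun q => ENNReal.ofReal (Real.exp (l * q.1.1))
      * ENNReal.ofReal (Real.exp (l * c n * X q.1.2 q.2))
    have hΦ : Measurable Φ := by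
      have h1 : Measurable fun q : (ℝ × T) × Ξ => X q.1.2 q.2 :=
        hX.comp (measurable_fst.snd.prodMk measurable_snd)
      have h2 : Measurable fun q : (ℝ × T) × Ξ => q.1.1 := measurable_fst.fst
      fun_prop
    have hstep := lintegral_comp_eq_of_indepFun (hMU.mono (pastSigma_le hξ n) le_rfl) (hξ n)
      (indepFun_of_measurable_pastSigma hξ hind hMU) (hlaw n) hΦ
    have hMm : Measurable fun ω => ENNReal.ofReal (Real.exp (l * M ω)) := by
      have := hM.mono (pastSigma_le hξ n) le_rfl
      fun_prop
    calc _ = ∫⁻ ω, Φ ((M ω, U n ω), ξ n ω) ∂P := by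
          refine lintegral_congr fun ω => ?_
          rw [Finset.sum_range_succ, mul_add, Real.exp_add,
            ENNReal.ofReal_mul (Real.exp_pos _).le, ← mul_assoc l (c n)]
      _ = ∫⁻ ω, ∫⁻ s, Φ ((M ω, U n ω), s) ∂ν ∂P := hstep
      _ ≤ ∫⁻ ω, ENNReal.ofReal (Real.exp (l * M ω))
            * ENNReal.ofReal (Real.exp ((l * c n) ^ 2 * r)) ∂P := by
          refine lintegral_mono fun ω => ?_
          simp only [Φ]
          rw [lintegral_const_mul' _ _ ENNReal.ofReal_ne_top]
          exact mul_le_mul_right (hmgf _ _) _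
      _ ≤ ENNReal.ofReal (Real.exp (l ^ 2 * (r * ∑ i ∈ Finset.range n, c i ^ 2)))
            * ENNReal.ofReal (Real.exp ((l * c n) ^ 2 * r)) := by
          rw [lintegral_mul_const _ hMm]
          exact mul_le_mul_left ih _
      _ = _ := by
          rw [← ENNReal.ofReal_mul (Real.exp_pos _).le, ← Real.exp_add, Finset.sum_range_succ]
          congr 2; ring

end Tail

/-! ### Measurability of the iterates -/

theorem IsArgMinOn.of_eq_add_const {E : Type*} {ψ ψ' : E → ℝ} {Q : Set E} {u : E}
    (h : IsArgMinOn ψ Q u) (C : ℝ) (heq : ∀ v ∈ Q, ψ v = ψ' v + C) : IsArgMinOn ψ' Q u := by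
  refine ⟨h.1, fun v hv => ?_⟩
  have := h.2 hv
  simp only [Set.mem_ofPred_eq, heq v hv, heq u h.1] at this ⊢
  linarith

theorem StrongConvexOn.mul_add_mul {E : Type*} [NormedAddCommGroup E] [NormedSpace ℝ E]
    {Q : Set E} {d h : E → ℝ} (hd : StrongConvexOn Q 1 d) (hh : ConvexOn ℝ Q h) {β A : ℝ}
    (hβ : 0 ≤ β) (hA : 0 ≤ A) : StrongConvexOn Q β (fun u => β * d u + A * h u) := by
  refine ⟨hd.1, fun x hx y hy a b ha hb hab => ?_⟩
  have h1 := mul_le_mul_of_nonneg_left (hd.2 hx hy ha hb hab) hβ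
  have h2 := mul_le_mul_of_nonneg_left (hh.2 hx hy ha hb hab) hA
  simp only [smul_eq_mul] at h1 h2 ⊢
  linarith

section Measurability

variable {E Ξ S : Type*} [NormedAddCommGroup E] [NormedSpace ℝ E] [FiniteDimensional ℝ E]
  [MeasurableSpace E] [BorelSpace E] [MeasurableSpace Ξ] [mS : MeasurableSpace S]
  {Q : Set E} {h d : E → ℝ} {G : E → Ξ → StrongDual ℝ E} {α β B : ℕ → ℝ}
  {ξ : ℕ → S → Ξ} {x y z xhat w : ℕ → S → E}

/-- The iterates of the method depend measurably on the noise of the steps made so far. -/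
theorem measurable_sigm (hh : ConvexOn ℝ Q h) {c : E} (hd : IsProxFunction Q d c)
    (hG : Measurable fun q : Q × Ξ => G q.1 q.2)
    (hrun : ∀ ω, IsSIGMRun Q h d G α β B (fun i => ξ i ω) (fun i => x i ω) (fun i => y i ω)
      (fun i => z i ω) (fun i => xhat i ω) (fun i => w i ω))
    (hmem : ∀ i ω, x i ω ∈ Q) (hα : ∀ i, 0 ≤ α i) (hβ : ∀ i, 0 < β i) (k : ℕ) :
    ((∀ i < k, Measurable (ξ i)) → Measurable (x k)) ∧
    ((∀ i ≤ k, Measurable (ξ i)) → Measurable (y k) ∧ Measurable (z k) ∧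
      Measurable fun ω => ∑ i ∈ Finset.range (k + 1), α i • G (x i ω) (ξ i ω)) := by
  have hcoef (k : ℕ) : 0 ≤ coefSum α k := Finset.sum_nonneg fun i _ => hα i
  have hGx {i : ℕ} (hx : Measurable (x i)) (hξ : Measurable (ξ i)) :
      Measurable fun ω => G (x i ω) (ξ i ω) :=
    hG.comp ((hx.subtype_mk (h := hmem i)).prodMk hξ)
  have hsmul (r : ℝ) {H : S → StrongDual ℝ E} (hH : Measurable H) :
      Measurable fun ω => r • H ω := (measurable_const_smul r).comp hH
  have hsmul' (r : ℝ) {v : S → E} (hv : Measurable v) :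
      Measurable fun ω => r • v ω := (measurable_const_smul r).comp hv
  have hstep {k : ℕ}
      (hs : Measurable fun ω => ∑ i ∈ Finset.range (k + 1), α i • G (x i ω) (ξ i ω))
      {u : S → E} (hu : ∀ ω, IsArgMinOn
        (fun v => β k * d v + ∑ i ∈ Finset.range (k + 1), α i * G (x i ω) (ξ i ω) (v - x i ω)
          + coefSum α k * h v) Q (u ω)) : Measurable u := by
    obtain ⟨Φ, hΦc, hΦ⟩ := exists_continuous_argmin (hβ k)
      (hd.strongConvexOn.mul_add_mul hh (hβ k).le (hcoef k))
    -- Up to a constant depending on ω, the objective is a fixed strongly convex function plus this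
    -- random functional.
    have hu' : u = fun ω => Φ (∑ i ∈ Finset.range (k + 1), α i • G (x i ω) (ξ i ω)) := by
      funext ω
      refine hΦ _ _ ((hu ω).of_eq_add_const
        (-∑ i ∈ Finset.range (k + 1), α i * G (x i ω) (ξ i ω) (x i ω)) fun v _ => ?_)
      simp only [map_sub, mul_sub, Finset.sum_sub_distrib, sum_apply,
        smul_apply, smul_eq_mul]
      ring
    rw [hu']
    exact hΦc.measurable.comp hs
  induction k with
  | zero =>
    have hx : Measurable (x 0) := by
      obtain ⟨Φ, -, hΦ⟩ := exists_continuous_argmin one_pos hd.strongConvexOn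
      have : x 0 = fun _ => Φ 0 := funext fun ω =>
        hΦ 0 _ ((hrun ω).x_zero.of_eq_add_const 0 fun v _ => by simp)
      rw [this]
      exact measurable_const
    refine ⟨fun _ => hx, fun hξ => ?_⟩
    have hs : Measurable fun ω => ∑ i ∈ Finset.range (0 + 1), α i • G (x i ω) (ξ i ω) := by
      simpa using hsmul (α 0) (hGx hx (hξ 0 le_rfl))
    -- As A_0 = α_0, y_0 and z_0 solve the same problem.
    refine ⟨hstep hs fun ω => ?_, hstep hs fun ω => (hrun ω).z_step 0, hs⟩
    simpa [coefSum_zero] using (hrun ω).y_zero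
  | succ k ih =>
    have hx : (∀ i < k + 1, Measurable (ξ i)) → Measurable (x (k + 1)) := fun hξ => by
      obtain ⟨hy, hz, -⟩ := ih.2 fun i hi => hξ i (Nat.lt_succ_of_le hi)
      rw [show x (k + 1) = _ from funext fun ω => (hrun ω).x_step k]
      exact (hsmul' _ hz).add (hsmul' _ hy)
    refine ⟨hx, fun hξ => ?_⟩
    obtain ⟨hy, hz, hs⟩ := ih.2 fun i hi => hξ i (hi.trans k.le_succ)
    have hx' := hx fun i hi => hξ i hi.le
    have hGk := hGx hx' (hξ (k + 1) le_rfl)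
    have hs' : Measurable fun ω =>
        ∑ i ∈ Finset.range (k + 1 + 1), α i • G (x i ω) (ξ i ω) := by
      simp only [Finset.sum_range_succ _ (k + 1)]
      exact hs.add (hsmul _ hGk)
    refine ⟨?_, hstep hs' fun ω => (hrun ω).z_step (k + 1), hs'⟩
    have hxhat : Measurable (xhat (k + 1)) := by
      obtain ⟨g, hgm, hg⟩ := exists_measurable_gradient hh.1 hd.differentiableOn
      obtain ⟨Φ, hΦc, hΦ⟩ := exists_continuous_argmin (hβ k)
        (hd.strongConvexOn.mul_add_mul hh (hβ k).le (hα (k + 1)))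
      have hzQ (ω : S) : z k ω ∈ Q := ((hrun ω).z_step k).1
      -- The Bregman term is d plus an affine function; its derivative acts only on v - z_k, where
      -- the measurable g agrees with it.
      have heq : xhat (k + 1) = fun ω => Φ (α (k + 1) • G (x (k + 1) ω) (ξ (k + 1) ω)
          - β k • g ⟨z k ω, hzQ ω⟩) := by
        funext ω
        refine hΦ _ _ (((hrun ω).xhat_step k).of_eq_add_const
          (-(α (k + 1) * G (x (k + 1) ω) (ξ (k + 1) ω) (z k ω))
            - β k * d (z k ω) + β k * g ⟨z k ω, hzQ ω⟩ (z k ω)) fun v hv => ?_)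
        rw [bregman, ← hg ⟨z k ω, hzQ ω⟩ v hv _ (hzQ ω)]
        simp only [map_sub, sub_apply, smul_apply, smul_eq_mul]
        ring
      rw [heq]
      have hgz : Measurable fun ω => g ⟨z k ω, hzQ ω⟩ := hgm.comp hz.subtype_mk
      exact hΦc.measurable.comp ((hsmul _ hGk).sub (hsmul _ hgz))
    have hw : Measurable (w (k + 1)) := by
      rw [show w (k + 1) = _ from funext fun ω => (hrun ω).w_step k]
      exact (hsmul' _ hxhat).add (hsmul' _ hy)
    rw [show y (k + 1) = _ from funext fun ω => (hrun ω).y_step k]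
    exact (hsmul' _ hy).add (hsmul' _ hw)

end Measurability

/-! ### The high-probability bound -/

/-- The noise term of the gap bound, as a function of the query point, the prox point and the
noise, is sub-Gaussian. -/
theorem lintegral_exp_noise_le {E Ξ : Type*} [NormedAddCommGroup E] [NormedSpace ℝ E]
    [FiniteDimensional ℝ E] [MeasurableSpace Ξ] {Q : Set E}
    (hQ : Bornology.IsBounded Q) (hD : 0 < Metric.diam Q) {σ : ℝ} (hσ : 0 < σ)
    {ν : Measure Ξ} [IsProbabilityMeasure ν] {gO : E → StrongDual ℝ E}
    {G : E → Ξ → StrongDual ℝ E} (hlight : LightTail Q σ ν gO G) {x u v : E} (hx : x ∈ Q)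
    (hu : u ∈ Q) (hv : v ∈ Q) (hmeas : Measurable (G x)) (hint : Integrable (G x) ν)
    (hmean : ∫ s, G x s ∂ν = gO x) (l : ℝ) :
    ∫⁻ s, ENNReal.ofReal (Real.exp (l * (G x s - gO x) (u - v))) ∂ν
      ≤ ENNReal.ofReal (Real.exp (l ^ 2 * (Metric.diam Q * σ) ^ 2)) := by
  have hsub : Integrable (fun s => G x s - gO x) ν := hint.sub (integrable_const _)
  refine lintegral_exp_mul_le (X := fun s => (G x s - gO x) (u - v)) ?_
    (hsub.apply_continuousLinearMap (u - v)) ?_ (mul_pos hD hσ) ?_ l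
  · exact (ContinuousLinearMap.measurable_apply (u - v)).comp (hmeas.sub_const (gO x))
  · rw [← ContinuousLinearMap.integral_apply hsub, integral_sub hint (integrable_const _), hmean]
    simp
  · refine (lintegral_mono fun s => ENNReal.ofReal_le_ofReal (Real.exp_le_exp.2 ?_)).trans
      (hlight x hx)
    have h1 : |(G x s - gO x) (u - v)| ≤ ‖G x s - gO x‖ * Metric.diam Q := by
      refine ((G x s - gO x).le_opNorm (u - v)).trans
        (mul_le_mul_of_nonneg_left ?_ (norm_nonneg _))
      rw [← dist_eq_norm]
      exact Metric.dist_le_diam_of_mem hQ hu hv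
    rw [div_le_div_iff₀ (by positivity) (by positivity), ← sq_abs]
    calc _ ≤ (‖G x s - gO x‖ * Metric.diam Q) ^ 2 * σ ^ 2 := by gcongr
      _ = _ := by ring

theorem theorem5 {E : Type*} [NormedAddCommGroup E] [NormedSpace ℝ E] [FiniteDimensional ℝ E]
    [MeasurableSpace E] [BorelSpace E]
    {Ξ : Type*} [MeasurableSpace Ξ] {S : Type*} [MeasurableSpace S]
    (P : Measure S) [IsProbabilityMeasure P]
    -- the problem: minimize `f + h` over `Q`, with solution `xs`
    (Q : Set E) (hQ_closed : IsClosed Q) (hQ_convex : Convex ℝ Q)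
    (f h : E → ℝ) (hf : ConvexOn ℝ Q f) (hh : ConvexOn ℝ Q h)
    (xs : E) (hxs : IsArgMinOn (fun u => f u + h u) Q xs)
    -- the prox-function
    (d : E → ℝ) (c : E) (hd : IsProxFunction Q d c)
    -- the stochastic inexact oracle
    (L δ σ : ℝ) (hL : 0 ≤ L) (hσ : 0 < σ)
    (ν : Measure Ξ) (fO : E → ℝ) (gO : E → StrongDual ℝ E)
    (F : E → Ξ → ℝ) (G : E → Ξ → StrongDual ℝ E)
    (horacle : IsStochasticInexactOracle Q f L δ σ ν fO gO F G)
    -- the noise is i.i.d. with law `ν`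
    (ξ : ℕ → S → Ξ) (hξ_meas : ∀ i, Measurable (ξ i)) (hξ_law : ∀ i, P.map (ξ i) = ν)
    (hξ_indep : iIndepFun ξ P)
    -- the light-tail condition
    (hlight : LightTail Q σ ν gO G)
    -- the feasible set is bounded; its diameter is `Metric.diam Q`
    (hQ_bounded : Bornology.IsBounded Q)
    -- the parameters of the method
    (p R : ℝ) (hp : p ∈ Set.Icc (1 : ℝ) 2) (hR_pos : 0 < R) (hR : √(2 * d xs) ≤ R)
    -- the sequences generated by the method
    (x y z xhat w : ℕ → S → E)
    (hrun : ∀ ω, IsSIGMRun Q h d G (sigmAlpha p) (sigmBeta L σ R p) (sigmB p)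
      (fun i => ξ i ω) (fun i => x i ω) (fun i => y i ω) (fun i => z i ω)
      (fun i => xhat i ω) (fun i => w i ω))
    (Om : ℝ) (hOm : 0 ≤ Om) (k : ℕ) :
    (1 ≤ k →
      P {ω | (f (y k ω) + h (y k ω)) - (f xs + h xs) >
          4 * √2 * L * R ^ 2 / (k : ℝ) ^ p
          + 16 * √2 * (1 + Om) * σ * R / √(k : ℝ)
          + 48 * (k : ℝ) ^ (p - 1) * δ
          + 4 * √3 * Metric.diam Q * σ * √Om / √(k : ℝ)}
      ≤ P {ω | (f (y k ω) + h (y k ω)) - (f xs + h xs) >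
          L * R ^ 2 * p ^ p * (2 : ℝ) ^ ((2 * p - 3) / 2) / ((k : ℝ) + p) ^ p
          + (1 + Om) * σ * R * (2 : ℝ) ^ ((3 + 2 * p) / 4) * √p
              * ((k : ℝ) + p + 2) ^ (p - 1 / 2) / ((k : ℝ) + p) ^ p
          + (2 : ℝ) ^ (2 * p - 1) * ((((k : ℝ) + p) / p) ^ (p - 1) + 1) * δ
          + 2 * Metric.diam Q * σ * √(6 * Om * p) / √((k : ℝ) + p)}) ∧
    P {ω | (f (y k ω) + h (y k ω)) - (f xs + h xs) >
          L * R ^ 2 * p ^ p * (2 : ℝ) ^ ((2 * p - 3) / 2) / ((k : ℝ) + p) ^ p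
          + (1 + Om) * σ * R * (2 : ℝ) ^ ((3 + 2 * p) / 4) * √p
              * ((k : ℝ) + p + 2) ^ (p - 1 / 2) / ((k : ℝ) + p) ^ p
          + (2 : ℝ) ^ (2 * p - 1) * ((((k : ℝ) + p) / p) ^ (p - 1) + 1) * δ
          + 2 * Metric.diam Q * σ * √(6 * Om * p) / √((k : ℝ) + p)}
      ≤ ENNReal.ofReal (3 * Real.exp (-Om)) := by
  obtain ⟨hp1, hp2⟩ := hp
  have hν : IsProbabilityMeasure ν :=
    hξ_law 0 ▸ Measure.isProbabilityMeasure_map (hξ_meas 0).aemeasurable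
  have hxsQ := hxs.1
  -- Both oracle inequalities at y = x force this.
  have hδ : 0 ≤ δ := by
    have h1 := horacle.lower xs hxsQ xs hxsQ
    have h2 := horacle.upper xs hxsQ xs hxsQ
    simp only [sub_self, norm_zero] at h1 h2
    linarith
  have hD : 0 ≤ Metric.diam Q := Metric.diam_nonneg
  have hdx : d xs ≤ R ^ 2 / 2 := by
    have := (Real.sqrt_le_left hR_pos.le).1 hR
    linarith
  have hα := sigmAlpha_pos hp1
  have hβL := lt_sigmBeta (L := L) hp1 hσ hR_pos
  have hαB := sigmAlpha_le_sigmB hp1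
  have hBA := sigmB_le_coefSum ⟨hp1, hp2⟩
  have hmem (i : ℕ) (ω : S) : x i ω ∈ Q :=
    ((hrun ω).mem hQ_convex (fun i => (hα i).le) (fun i => (hα i).trans_le (hαB i)) hαB hBA i).1
  refine ⟨fun hk => measure_mono fun ω hω => lt_of_le_of_lt
    (exact_bound_le_simple_bound ⟨hp1, hp2⟩ hL hσ hR_pos hδ hD hOm hk) hω, ?_⟩
  -- the two random quantities
  let c' : ℕ → ℝ := fun i => sigmB p i / (2 * (sigmBeta L σ R p i - L))
  have hc'pos (i : ℕ) : 0 < c' i :=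
    div_pos ((hα i).trans_le (hαB i)) (by linarith [hβL i])
  let Y : ℕ → S → ℝ := fun i ω => ‖G (x i ω) (ξ i ω) - gO (x i ω)‖ ^ 2 / σ ^ 2
  let M : S → ℝ := fun ω => ∑ i ∈ Finset.range (k + 1), sigmAlpha p i *
    (G (x i ω) (ξ i ω) - gO (x i ω)) (xs - proxPoint (fun i => x i ω) (fun i => z i ω) i)
  have hprox (i : ℕ) (ω : S) : proxPoint (fun i => x i ω) (fun i => z i ω) i ∈ Q := by
    cases i with
    | zero => exact hmem 0 ω
    | succ i => exact ((hrun ω).z_step i).1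
  -- measurability
  have hβ0 (i : ℕ) : 0 < sigmBeta L σ R p i := hL.trans_lt (hβL i)
  -- `measurable_sigm` allows any σ-algebra on `S`; taking the past of step i turns measurability
  -- into adaptedness.
  have hxm (i : ℕ) : Measurable[pastSigma ξ i] (x i) :=
    (measurable_sigm (mS := pastSigma ξ i) hh hd horacle.measurable_G hrun hmem
      (fun i => (hα i).le) hβ0 i).1 fun j hj => measurable_pastSigma ξ hj
  have hpm (i : ℕ) : Measurable[pastSigma ξ i]
      fun ω => proxPoint (fun i => x i ω) (fun i => z i ω) i := by
    cases i with
    | zero => exact hxm 0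
    | succ i =>
      exact ((measurable_sigm (mS := pastSigma ξ (i + 1)) hh hd horacle.measurable_G hrun hmem
        (fun i => (hα i).le) hβ0 i).2 fun j hj => measurable_pastSigma ξ
          (Nat.lt_succ_of_le hj)).2.1
  -- The mean of a jointly measurable G is measurable in the query point.
  have hgO : Measurable fun q : Q => gO q := by
    have h1 : StronglyMeasurable (Function.uncurry fun (q : Q) (s : Ξ) => G q s) :=
      horacle.measurable_G.stronglyMeasurable
    have h2 := (h1.integral_prod_right (ν := ν)).measurable
    refine (funext fun q => ?_ : (fun q : Q => gO q) = _) ▸ h2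
    exact (horacle.integral_G q q.2).symm
  let U : ℕ → S → Q × Q := fun i ω => (⟨x i ω, hmem i ω⟩, ⟨_, hprox i ω⟩)
  have hU (i : ℕ) : Measurable[pastSigma ξ i] (U i) :=
    (hxm i).subtype_mk.prodMk (hpm i).subtype_mk
  have hη : Measurable fun q : (Q × Q) × Ξ => G q.1.1 q.2 - gO q.1.1 :=
    (horacle.measurable_G.comp (measurable_fst.fst.prodMk measurable_snd)).sub
      (hgO.comp measurable_fst.fst)
  let X : Q × Q → Ξ → ℝ := fun t s => (G t.1 s - gO t.1) (xs - t.2)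
  have hX : Measurable (Function.uncurry X) := by
    have hev : Continuous fun q : StrongDual ℝ E × E => q.1 q.2 :=
      isBoundedBilinearMap_apply.continuous
    have h1 : Measurable fun q : (Q × Q) × Ξ => xs - (q.1.2 : E) :=
      (measurable_subtype_coe.comp measurable_fst.snd).const_sub xs
    exact hev.measurable.comp (hη.prodMk h1)
  have hUξ (i : ℕ) : Measurable fun ω => (U i ω, ξ i ω) :=
    ((hU i).mono (pastSigma_le hξ_meas i) le_rfl).prodMk (hξ_meas i)
  -- the squared noise
  have hYtail : P {ω | (1 + Om) * ∑ i ∈ Finset.range (k + 1), c' i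
      < ∑ i ∈ Finset.range (k + 1), c' i * Y i ω} ≤ ENNReal.ofReal (Real.exp (-Om)) := by
    have hΦ : Measurable fun q : (Q × Q) × Ξ => ‖G q.1.1 q.2 - gO q.1.1‖ ^ 2 / σ ^ 2 :=
      (hη.norm.pow_const 2).div_const _
    refine measure_sum_lt_le _ (fun i _ => hΦ.comp (hUξ i)) (fun i _ => (hc'pos i).le)
      (Finset.sum_pos (fun i _ => hc'pos i) ⟨0, by simp⟩) (fun i _ => ?_) Om
    have hΦ' : Measurable fun q : (Q × Q) × Ξ =>
        ENNReal.ofReal (Real.exp (‖G q.1.1 q.2 - gO q.1.1‖ ^ 2 / σ ^ 2)) :=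
      (Real.measurable_exp.comp hΦ).ennreal_ofReal
    have h1 := lintegral_comp_eq_of_indepFun ((hU i).mono (pastSigma_le hξ_meas i) le_rfl)
      (hξ_meas i) (indepFun_of_measurable_pastSigma hξ_meas hξ_indep (hU i)) (hξ_law i) hΦ'
    refine h1.trans_le ((lintegral_mono fun ω => hlight (x i ω) (hmem i ω)).trans ?_)
    simp
  -- the martingale
  have hMtail : P {ω | Metric.diam Q * σ *
      √(24 * Om * ∑ i ∈ Finset.range (k + 1), sigmAlpha p i ^ 2) < M ω}
      ≤ ENNReal.ofReal (Real.exp (-Om)) := by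
    -- If the diameter is 0, Q is one point and M vanishes; the sub-Gaussian bound needs a positive
    -- variance parameter.
    rcases hD.eq_or_lt with hD0 | hD0
    · have hM0 (ω : S) : M ω = 0 := by
        refine Finset.sum_eq_zero fun i _ => ?_
        have h1 : dist xs (proxPoint (fun i => x i ω) (fun i => z i ω) i) ≤ 0 :=
          (Metric.dist_le_diam_of_mem hQ_bounded hxsQ (hprox i ω)).trans hD0.ge
        rw [sub_eq_zero.2 (dist_le_zero.1 h1), map_zero, mul_zero]
      simp [hM0, ← hD0]
    · set A2 := ∑ i ∈ Finset.range (k + 1), sigmAlpha p i ^ 2 with hA2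
      have hA2pos : 0 < A2 := Finset.sum_pos (fun i _ => pow_pos (hα i) 2) ⟨0, by simp⟩
      have hmgf := lintegral_exp_sum_le (X := X) (r := (Metric.diam Q * σ) ^ 2) hξ_meas hξ_law
        hξ_indep hU hX (fun t l => lintegral_exp_noise_le hQ_bounded hD0 hσ hlight t.1.2 hxsQ
          t.2.2 (horacle.measurable_G.comp (measurable_prodMk_left (x := t.1)))
          (horacle.integrable_G _ t.1.2) (horacle.integral_G _ t.1.2) l) (sigmAlpha p) (k + 1)
      have hMm : Measurable M := Finset.measurable_sum _ fun i _ =>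
        (hX.comp (hUξ i)).const_mul _
      refine (measure_lt_le_of_subgaussian hMm (by positivity) (by positivity) hmgf).trans
        (ENNReal.ofReal_le_ofReal (Real.exp_le_exp.2 (neg_le_neg ?_)))
      rw [mul_pow, Real.sq_sqrt (by positivity)]
      -- The Chernoff exponent t²/(4v) equals 6Ω, more than the Ω required.
      have : (Metric.diam Q * σ) ^ 2 * (24 * Om * A2) / (4 * ((Metric.diam Q * σ) ^ 2 * A2))
          = 6 * Om := by
        field_simp; ring
      rw [this]
      linarith
  -- the union bound
  refine (measure_mono (t := {ω | (1 + Om) * ∑ i ∈ Finset.range (k + 1), c' i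
      < ∑ i ∈ Finset.range (k + 1), c' i * Y i ω} ∪ {ω | Metric.diam Q * σ *
      √(24 * Om * ∑ i ∈ Finset.range (k + 1), sigmAlpha p i ^ 2) < M ω}) fun ω hω => ?_).trans
    ((measure_union_le _ _).trans ((add_le_add hYtail hMtail).trans ?_))
  · by_contra hcon
    rw [Set.mem_union, not_or] at hcon
    obtain ⟨h1, h2⟩ := hcon
    simp only [Set.mem_ofPred_eq, not_lt] at h1 h2
    rw [Set.mem_ofPred_eq, gt_iff_lt] at hω
    refine absurd hω (not_lt.2 ?_)
    have hdet := (hrun ω).coefSum_mul_gap_le hf hh hd horacle.lower horacle.upper hα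
      (sigmAlpha_zero_le_one hp1) (sigmB_zero hp1) hβL hL (sigmBeta_mono hp1 hσ hR_pos) hαB hBA
      (sigmAlpha_sq_mul_sigmBeta_le hp1 hL hσ hR_pos) k hxsQ
    refine gap_le_of_noise_le ⟨hp1, hp2⟩ hL hσ hR_pos hδ hD hOm hdx k hdet ?_ h2
    have h3 : ∑ i ∈ Finset.range (k + 1),
        sigmB p i / (2 * (sigmBeta L σ R p i - L)) * ‖G (x i ω) (ξ i ω) - gO (x i ω)‖ ^ 2
        = σ ^ 2 * ∑ i ∈ Finset.range (k + 1), c' i * Y i ω := by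
      rw [Finset.mul_sum]
      refine Finset.sum_congr rfl fun i _ => ?_
      simp only [c', Y]
      field_simp
    rw [h3]
    refine (mul_le_mul_of_nonneg_left h1 (sq_nonneg σ)).trans_eq ?_
    ring
  · rw [← ENNReal.ofReal_add (Real.exp_pos _).le (Real.exp_pos _).le]
    exact ENNReal.ofReal_le_ofReal (by linarith [Real.exp_pos (-Om)])
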